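/- Let $\mathbb F_q$ be a finite field, let $t,m_1,\dots,m_t,n_1,\dots,n_t$ be positive integers with $m_1\ge\cdots\ge m_t$ and $m_i\ge n_i$ for all $i$, and put $n=n_1+\cdots+n_t$ and $\mathbb M=\mathbb F_q^{m_1\times n_1}\times\cdots\times\mathbb F_q^{m_t\times n_t}$. A code is an $\mathbb F_q$-linear subspace of $\mathbb M$. For $C=(C_1,\dots,C_t)\in\mathbb M$ let $\mathrm{srk}(C)=\sum_i\mathrm{rk}(C_i)$. For a code $\mathcal C$ let $\mathrm{maxsrk}(\mathcal C)=\max_{C\in\mathcal C}\mathrm{srk}(C)$ and, if $\mathcal C\ne0$, $d(\mathcal C)=\min_{0\ne C\in\mathcal C}\mathrm{srk}(C)$. A subspace $\mathcal A\subseteq\mathbb F_q^{m_i\times n_i}$ is an optimal anticode if $\dim\mathcal A=m_i\max_{A\in\mathcal A}\mathrm{rk}(A)$. The weight $\mathrm{wt}(\mathcal C)$ of a code is the minimum of $\mathrm{maxsrk}(\mathcal A)$ over all $\mathcal A=\mathcal A_1\times\cdots\times\mathcal A_t\supseteq\mathcal C$ where each $\mathcal A_i\subseteq\mathbb F_q^{m_i\times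 n_i}$ is an optimal anticode. For $1\le r\le\dim\mathcal C$, the $r$-th generalized (sum-rank) weight is $d_r(\mathcal C)=\min\{\mathrm{wt}(\mathcal U):\mathcal U\subseteq\mathcal C,\ \dim\mathcal U\ge r\}$; the sequence of generalized weights of $\mathcal C$ is $d_1(\mathcal C),\dots,d_{\dim\mathcal C}(\mathcal C)$. The code $\mathcal C$ satisfies the chain condition if there are codes $0\subsetneq\mathcal U_1\subsetneq\cdots\subsetneq\mathcal U_{k}=\mathcal C$, $k=\dim\mathcal C$, with $\mathrm{wt}(\mathcal U_r)=d_r(\mathcal C)$ for $1\le r\le k$. A greedy $1$-subcode of $\mathcal C$ is a $1$-dimensional $\mathcal U\subseteq\mathcal C$ with $\mathrm{wt}(\mathcal U)=d_1(\mathcal C)$; for $2\le r\le\dim\mathcal C$ a greedy $r$-subcode is an $r$-dimensional subcode of minimum weight among those that contain a greedy $(r-1)$-subcode; the $r$-th greedy weight of $\mathcal C$ is the weight of any greedy $r$-subcode. The code $\mathcal C$ is MSRD if there are $j\in\{1,\dots,t\}$ and $0\le\delta\le n_j-1$ with $d(\mathcal C)=\sum_{i=1}^{j-1}n_i+\delta+1$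 and $\dim\mathcal C=\sum_{i=j}^t m_in_i-\delta m_j$. **Theorem.** Let $\mathcal D\subseteq\mathbb M$ be an MSRD code of minimum distance $d$ and assume that there is a chain of MSRD codes $\mathcal D=\mathcal D_d\supseteq\mathcal D_{d+1}\supseteq\cdots\supseteq\mathcal D_n$ with $d(\mathcal D_h)=h$ for $d\le h\le n$. A sequence of positive integers $d_1,\dots,d_k$ is the sequence of generalized weights of a code $\mathcal C\subseteq\mathcal D$ if and only if $k\le\dim\mathcal D$ and $d_1,\dots,d_k$ is a subsequence of the sequence of generalized weights of $\mathcal D$. Moreover, in that case $\mathcal C$ may be chosen such that it satisfies the chain condition and such that $d_1,\dots,d_k$ is also its sequence of greedy weights. In particular, every subsequence of the sequence of generalized weights of $\mathcal D$ is the sequence of greedy weights of a subcode of $\mathcal D$. -/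

import Mathlib

namespace SumRank

/-- The space `𝕄 = F^{m₁ × n₁} × ⋯ × F^{m_t × n_t}`. -/
abbrev Ambient (F : Type*) {t : ℕ} (m n : Fin t → ℕ) : Type _ :=
  ∀ i : Fin t, Matrix (Fin (m i)) (Fin (n i)) F

/-- A sum-rank metric code is an `F`-linear subspace of `𝕄`. -/
abbrev Code (F : Type*) [Field F] {t : ℕ} (m n : Fin t → ℕ) : Type _ :=
  Submodule F (Ambient F m n)

section

variable {F : Type*} [Field F] {t : ℕ} {m n : Fin t → ℕ}

/-- The sum-rank weight of an element of `𝕄`. -/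
noncomputable def srk (X : Ambient F m n) : ℕ := ∑ i, (X i).rank

/-- The minimum distance of a nonzero code (it is `0` for the zero code). -/
noncomputable def minDist (C : Code F m n) : ℕ :=
  sInf {w | ∃ X ∈ C, X ≠ 0 ∧ srk X = w}

/-- The maximum sum-rank distance of a code; sum-ranks are at most `∑ i, n i`, so this supremum
in `ℕ` is a maximum. -/
noncomputable def maxSrk (C : Code F m n) : ℕ :=
  sSup {w | ∃ X ∈ C, srk X = w}

/-- The maximum rank of an element of a space of `a × b` matrices. -/
noncomputable def maxRank {a b : ℕ} (A : Submodule F (Matrix (Fin a) (Fin b) F)) : ℕ :=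
  sSup {w | ∃ X ∈ A, X.rank = w}

/-- Optimal anticodes in `F^{a × b}` (where `b ≤ a`): the spaces of matrices that attain the
bound `dim A ≤ a · maxrk A`. -/
def IsOptimalAnticode {a b : ℕ} (A : Submodule F (Matrix (Fin a) (Fin b) F)) : Prop :=
  Module.finrank F A = a * maxRank A

/-- The weight of a code: the least maximum sum-rank of a product of optimal anticodes which
contains it. -/
noncomputable def wt (C : Code F m n) : ℕ :=
  sInf {w | ∃ A : ∀ i : Fin t, Submodule F (Matrix (Fin (m i)) (Fin (n i)) F),
    (∀ i, IsOptimalAnticode (A i)) ∧ C ≤ Submodule.pi Set.univ A ∧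
      maxSrk (m := m) (n := n) (Submodule.pi Set.univ A) = w}

/-- The `r`-th generalized sum-rank weight of `C`, for `1 ≤ r ≤ dim C`. -/
noncomputable def genWeight (C : Code F m n) (r : ℕ) : ℕ :=
  sInf {w | ∃ U : Code F m n, U ≤ C ∧ r ≤ Module.finrank F U ∧ wt U = w}

/-- The sequence `d₁(C), …, d_k(C)` of generalized weights of `C`, where `k = dim C`. -/
noncomputable def genWeights (C : Code F m n) : List ℕ :=
  List.ofFn fun r : Fin (Module.finrank F C) => genWeight C (r + 1)

/-- `C` is maximum sum-rank distance: for some `j` and some `0 ≤ δ ≤ n_j - 1`,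
`d(C) = ∑_{i < j} n_i + δ + 1` and `dim C = ∑_{i ≥ j} m_i n_i - δ m_j`. -/
def IsMSRD (C : Code F m n) : Prop :=
  ∃ (j : Fin t) (δ : ℕ), δ < n j ∧
    minDist C = (∑ i ∈ Finset.Iio j, n i) + δ + 1 ∧
    Module.finrank F C + δ * m j = ∑ i ∈ Finset.Ici j, m i * n i

/-- `IsGreedySubcode C r U` : `U` is a greedy `r`-subcode of `C` (`r ≥ 1`). -/
def IsGreedySubcode (C : Code F m n) : ℕ → Code F m n → Prop
  | 0, _ => False
  | 1, U => U ≤ C ∧ Module.finrank F U = 1 ∧ wt U = genWeight C 1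
  | r + 2, U =>
    (U ≤ C ∧ Module.finrank F U = r + 2 ∧ ∃ V ≤ U, IsGreedySubcode C (r + 1) V) ∧
    ∀ U' : Code F m n,
      (U' ≤ C ∧ Module.finrank F U' = r + 2 ∧ ∃ V ≤ U', IsGreedySubcode C (r + 1) V) →
        wt U ≤ wt U'

/-- All greedy `r`-subcodes of `C` have the same weight. -/
theorem IsGreedySubcode.wt_eq {C : Code F m n} {r : ℕ} {U V : Code F m n}
    (hU : IsGreedySubcode C r U) (hV : IsGreedySubcode C r V) : wt U = wt V := by
  match r with
  | 0 => exact absurd hU (by simp [IsGreedySubcode])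
  | 1 =>
    simp only [IsGreedySubcode] at hU hV
    rw [hU.2.2, hV.2.2]
  | r + 2 =>
    simp only [IsGreedySubcode] at hU hV
    exact le_antisymm (hU.2 V hV.1) (hV.2 U hU.1)

/-- The `r`-th greedy weight of `C`, for `1 ≤ r ≤ dim C`: the common weight of its greedy
`r`-subcodes. -/
noncomputable def greedyWeight (C : Code F m n) (r : ℕ) : ℕ :=
  sInf {w | ∃ U : Code F m n, IsGreedySubcode C r U ∧ wt U = w}

theorem IsGreedySubcode.wt_eq_greedyWeight {C : Code F m n} {r : ℕ} {U : Code F m n}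
    (hU : IsGreedySubcode C r U) : wt U = greedyWeight C r := by
  have h : {w | ∃ V : Code F m n, IsGreedySubcode C r V ∧ wt V = w} = {wt U} := by
    ext w
    constructor
    · rintro ⟨V, hV, rfl⟩
      exact hV.wt_eq hU
    · rintro rfl
      exact ⟨U, hU, rfl⟩
  rw [greedyWeight, h, csInf_singleton]

/-- The sequence `g₁(C), …, g_k(C)` of greedy weights of `C`, where `k = dim C`. -/
noncomputable def greedyWeights (C : Code F m n) : List ℕ :=
  List.ofFn fun r : Fin (Module.finrank F C) => greedyWeight C (r + 1)

/-- The chain condition: there are `0 = U₀ ⊊ U₁ ⊊ ⋯ ⊊ U_k = C`, `k = dim C`, such that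
`d_r(C) = wt(U_r)` for `1 ≤ r ≤ k`. (The zero code satisfies it trivially.) -/
def ChainCondition (C : Code F m n) : Prop :=
  ∃ U : ℕ → Code F m n, U 0 = ⊥ ∧ U (Module.finrank F C) = C ∧
    (∀ r < Module.finrank F C, U r < U (r + 1)) ∧
    ∀ r, 1 ≤ r → r ≤ Module.finrank F C → genWeight C r = wt (U r)

end

end SumRank

/-!
Order the columns of the blocks from left to right and give each column the height `m i` of its
block. Every anticode loses a unit of rank when it is cut down by at most as many dimensions as its
matrices have rows: this is a Kőnig-type argument on the leading positions of matrices. As the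
heights decrease, the generalized weights of any code therefore take the value `w` at most as often
as the height of the `w`-th column. In the given chain, a dimension count shows that
`E w ⊓ prefixCode w`, whose nonzero elements have sum-rank exactly `w`, is at least as large as this
height. Bases of these spaces, taken in order of `w`, form a basis of `E d` whose `s`-th vector has
the `s`-th generalized weight, and any subfamily spans a code with the corresponding weights.
-/

namespace SumRank

open Module
open scoped Matrix Finset

section LinearIndependence

variable {F E ι : Type*} [Field F] [AddCommGroup E] [Module F E]

theorem linearIndepOn_update_or_update_add [DecidableEq ι] {y : ι → E} {s : Set ι} {p : ι}
    (hp : p ∈ s) (hy : LinearIndepOn F y s) (u : E) :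
    LinearIndepOn F (Function.update y p u) s ∨
      LinearIndepOn F (Function.update y p (u + y p)) s := by
  obtain ⟨t, hpt, rfl⟩ : ∃ t, p ∉ t ∧ s = insert p t := ⟨s \ {p}, by simp, by simp [hp]⟩
  have hcongr (z : E) : Set.EqOn (Function.update y p z) y t := fun i hi =>
    Function.update_of_ne (ne_of_mem_of_not_mem hi hpt) _ _
  have hupdate (z : E) : LinearIndepOn F (Function.update y p z) (insert p t) ↔
      LinearIndepOn F y t ∧ z ∉ Submodule.span F (y '' t) := by
    rw [linearIndepOn_insert hpt, linearIndepOn_congr (hcongr z), (hcongr z).image_eq,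
      Function.update_self]
  obtain ⟨hyt, hyp⟩ := (linearIndepOn_insert hpt).1 hy
  simp only [hupdate, hyt, true_and]
  by_cases hu : u ∈ Submodule.span F (y '' t)
  · exact Or.inr fun h => hyp ((Submodule.add_mem_iff_right _ hu).1 h)
  · exact Or.inl hu

theorem linearIndepOn_of_leading {κ : Type*} [LinearOrder κ] {v : ι → κ → F} {h : ι → κ}
    {s : Finset ι} (hinj : Set.InjOn h s) (hne : ∀ i ∈ s, v i (h i) ≠ 0)
    (hlt : ∀ i ∈ s, ∀ j < h i, v i j = 0) : LinearIndepOn F v (s : Set ι) := by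
  classical
  rw [linearIndepOn_finset_iff]
  intro c hc
  by_contra! hcon
  obtain ⟨i₀, hi₀, hci₀⟩ := hcon
  obtain ⟨i, hi, hmin⟩ := Finset.exists_min_image (s.filter (c · ≠ 0)) h
    ⟨i₀, Finset.mem_filter.2 ⟨hi₀, hci₀⟩⟩
  obtain ⟨his, hci⟩ := Finset.mem_filter.1 hi
  have hothers : ∀ k ∈ s, k ≠ i → (c k • v k) (h i) = 0 := fun k hk hki => by
    by_cases hck : c k = 0
    · simp [hck]
    · have hlt' := (hmin k (Finset.mem_filter.2 ⟨hk, hck⟩)).lt_of_ne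
        fun e => hki (hinj hk his e.symm)
      simp [hlt k hk _ hlt']
  have hsum := congrFun hc (h i)
  rw [Finset.sum_apply, Finset.sum_eq_single_of_mem i his hothers] at hsum
  exact (mul_ne_zero hci (hne i his)) hsum

theorem exists_linearEquiv_apply_eq {x z : E} (hx : x ≠ 0) (hz : z ≠ 0) :
    ∃ g : E ≃ₗ[F] E, g x = z := by
  let e := (LinearEquiv.toSpanNonzeroSingleton F E x hx).symm ≪≫ₗ
    LinearEquiv.toSpanNonzeroSingleton F E z hz
  obtain ⟨g, hg⟩ := Submodule.exists_linearEquiv_restrict_eq e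
  refine ⟨g, ?_⟩
  have hgx := hg (LinearEquiv.toSpanNonzeroSingleton F E x hx 1)
  rw [LinearEquiv.trans_apply, LinearEquiv.symm_apply_apply] at hgx
  simpa using hgx.symm

theorem exists_linearIndependent_apply_eq [Fintype ι] [FiniteDimensional F E]
    (hcard : Fintype.card ι ≤ finrank F E) (l : ι) {z : E} (hz : z ≠ 0) :
    ∃ y : ι → E, LinearIndependent F y ∧ y l = z := by
  obtain ⟨e⟩ : Nonempty (ι ↪ Fin (finrank F E)) :=
    Function.Embedding.nonempty_of_card_le (by simpa using hcard)
  have hli := (finBasis F E).linearIndependent.comp e e.injective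
  obtain ⟨g, hg⟩ := exists_linearEquiv_apply_eq (F := F) (hli.ne_zero l) hz
  exact ⟨g ∘ finBasis F E ∘ e, hli.map' g.toLinearMap g.ker, hg⟩

theorem eq_zero_of_forall_linearIndependent [Finite ι] [FiniteDimensional F E] {E' : Type*}
    [AddCommGroup E'] [Module F E'] (hcard : Nat.card ι ≤ finrank F E) (L : (ι → E) →ₗ[F] E')
    (hL : ∀ y : ι → E, LinearIndependent F y → L y = 0) : L = 0 := by
  classical
  cases nonempty_fintype ι
  rw [Nat.card_eq_fintype_card] at hcard
  refine LinearMap.pi_ext fun l z => ?_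
  rcases eq_or_ne z 0 with rfl | hz
  · simp
  rw [LinearMap.zero_apply]
  by_cases hl : ∃ l', l' ≠ l
  · obtain ⟨l', hl'⟩ := hl
    obtain ⟨y, hy, rfl⟩ := exists_linearIndependent_apply_eq hcard l' hz
    let c : ι → F := Pi.single l 1
    have hadd : LinearIndependent F (y + (c · • y l')) :=
      (linearIndependent_add_smul_iff (Pi.single_eq_of_ne hl' 1)).2 hy
    have hsingle : Pi.single l (y l') = (c · • y l') := by
      ext i
      rcases eq_or_ne i l with rfl | hi <;> simp [c, *]
    rw [hsingle, ← add_sub_cancel_left y (c · • y l'), map_sub, hL _ hadd, hL _ hy, sub_zero]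
  · push Not at hl
    have : Unique ι := ⟨⟨l⟩, hl⟩
    refine hL _ (linearIndependent_unique_iff.2 ?_)
    simpa [hl default] using hz

end LinearIndependence

section Koenig

variable {ι κ : Type*} [Fintype ι] [DecidableEq ι] [DecidableEq κ]

/-- Hall's theorem with deficiency: adjoining `e` dummy elements to every `P i` establishes Hall's
condition. -/
theorem exists_injOn_mem_card_compl_le [Nonempty κ] {e : ℕ} {P : ι → Finset κ}
    (hP : ∀ S : Finset ι, #S ≤ #(S.biUnion P) + e) :
    ∃ (S : Finset ι) (g : ι → κ), Set.InjOn g S ∧ (∀ i ∈ S, g i ∈ P i) ∧ #Sᶜ ≤ e := by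
  let t : ι → Finset (κ ⊕ Fin e) := fun i => (P i).disjSum Finset.univ
  have hHall : ∀ S : Finset ι, #S ≤ #(S.biUnion t) := by
    intro S
    rcases S.eq_empty_or_nonempty with rfl | hS
    · simp
    have hunion : S.biUnion t = (S.biUnion P).disjSum Finset.univ := by
      ext (j | j)
      · simp [t]
      · simpa [t, Finset.Nonempty] using hS
    simpa [hunion, Finset.card_disjSum] using hP S
  obtain ⟨h, hinj, hmem⟩ := (Finset.all_card_le_biUnion_card_iff_exists_injective t).1 hHall
  let S : Finset ι := Finset.univ.filter fun i => (h i).isLeft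
  have hleft : ∀ i ∈ S, ∃ j, h i = Sum.inl j := fun i hi =>
    Sum.isLeft_iff.1 (Finset.mem_filter.1 hi).2
  have hright : ∀ i ∈ Sᶜ, ∃ j, h i = Sum.inr j := fun i hi =>
    Sum.isRight_iff.1 (by simpa [S] using hi)
  choose! g hg using hleft
  have himage : Sᶜ.image h ⊆ Finset.univ.map Function.Embedding.inr := fun x hx => by
    obtain ⟨i, hi, rfl⟩ := Finset.mem_image.1 hx
    obtain ⟨j, hj⟩ := hright i hi
    simp [hj]
  refine ⟨S, g, fun i hi j hj hij => hinj (by rw [hg i hi, hg j hj, hij]),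
    fun i hi => Finset.inl_mem_disjSum.1 (hg i hi ▸ hmem i), ?_⟩
  simpa [Finset.card_image_of_injective _ hinj] using Finset.card_le_card himage

theorem exists_card_biUnion_add_card_compl_le {r : ℕ} (P : ι → Finset κ)
    (hP : ∀ (S : Finset ι) (h : ι → κ), Set.InjOn h S → (∀ i ∈ S, h i ∈ P i) → #S ≤ r) :
    ∃ S : Finset ι, #(S.biUnion P) + #Sᶜ ≤ r := by
  cases isEmpty_or_nonempty κ
  · exact ⟨Finset.univ, by simp [Finset.eq_empty_of_isEmpty]⟩
  by_contra! hcon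
  have hrι : r < Fintype.card ι := by simpa using hcon ∅
  obtain ⟨S, g, hinj, hmem, hSc⟩ :=
    exists_injOn_mem_card_compl_le (P := P) (e := Fintype.card ι - r - 1) fun S => by
      have hcover := hcon S
      have hcompl := S.card_add_card_compl
      omega
  have hS := hP S g hinj hmem
  have hcompl := S.card_add_card_compl
  omega

end Koenig

section LeadingPositions

variable {F ι κ : Type*} [Field F] [LinearOrder ι]

theorem exists_linearIndepOn_row {A : Submodule F (Matrix ι κ F)} {S : Finset ι}
    {N : ι → Matrix ι κ F} (hN : ∀ i ∈ S, N i ∈ A) (hzero : ∀ i ∈ S, ∀ l < i, N i l = 0)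
    (hli : LinearIndepOn F (fun i => N i i) (S : Set ι)) :
    ∃ M ∈ A, LinearIndepOn F M.row (S : Set ι) := by
  suffices ∀ T ⊆ S, ∃ M ∈ A,
      LinearIndepOn F (T.piecewise M.row fun i => N i i) (S : Set ι) by
    obtain ⟨M, hMA, hM⟩ := this S subset_rfl
    exact ⟨M, hMA, hM.congr fun i hi => Finset.piecewise_eq_of_mem _ _ _ hi⟩
  intro T
  induction T using Finset.induction_on_max with
  | empty => exact fun _ => ⟨0, A.zero_mem, by simpa using hli⟩
  | insert p T hmax ih =>
    intro hT
    obtain ⟨hpS, hTS⟩ := Finset.insert_subset_iff.1 hT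
    obtain ⟨M, hMA, hM⟩ := ih hTS
    have hpT : p ∉ T := fun hp => lt_irrefl p (hmax p hp)
    -- `N p` vanishes above its row `p`, so adding it to `M` only changes the `p`-th entry.
    have hadd : (insert p T).piecewise (M + N p).row (fun i => N i i) =
        Function.update (T.piecewise M.row fun i => N i i) p (M.row p + N p p) := by
      rw [Finset.piecewise_insert]
      refine congrArg (Function.update · p _) (T.piecewise_congr (fun i hi => ?_) fun _ _ => rfl)
      ext j
      simp [hzero p hpS i (hmax i hi)]
    rcases linearIndepOn_update_or_update_add hpS hM (M.row p) with h | h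
    · exact ⟨M, hMA, by rwa [Finset.piecewise_insert]⟩
    · refine ⟨M + N p, A.add_mem hMA (hN p hpS), ?_⟩
      rw [hadd]
      rwa [Finset.piecewise_eq_of_notMem _ _ _ hpT] at h

variable [Fintype κ] [LinearOrder κ]

open Classical in
/-- The positions of the leading entries of the `i`-th rows of those elements of a matrix space
whose rows above the `i`-th one vanish. -/
noncomputable def leadingPositions (A : Submodule F (Matrix ι κ F)) (i : ι) : Finset κ :=
  {j | ∃ M ∈ A, (∀ l < i, M l = 0) ∧ (∀ k < j, M i k = 0) ∧ M i j ≠ 0}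

theorem mem_leadingPositions {A : Submodule F (Matrix ι κ F)} {i : ι} {j : κ} :
    j ∈ leadingPositions A i ↔
      ∃ M ∈ A, (∀ l < i, M l = 0) ∧ (∀ k < j, M i k = 0) ∧ M i j ≠ 0 := by
  simp [leadingPositions]

theorem row_eq_zero_of_leadingPositions {A : Submodule F (Matrix ι κ F)} {M : Matrix ι κ F}
    (hM : M ∈ A) {i : ι} (hlt : ∀ l < i, M l = 0) (h : ∀ j ∈ leadingPositions A i, M i j = 0) :
    M i = 0 := by
  classical
  ext j
  induction j using WellFoundedLT.induction with | _ j ih =>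
  by_contra hj
  exact hj (h j (mem_leadingPositions.2 ⟨M, hM, hlt, ih, hj⟩))

theorem eq_zero_of_leadingPositions [Finite ι] {A : Submodule F (Matrix ι κ F)}
    {M : Matrix ι κ F} (hM : M ∈ A) (h : ∀ i, ∀ j ∈ leadingPositions A i, M i j = 0) :
    M = 0 := by
  funext i
  induction i using WellFoundedLT.induction with | _ i ih =>
  exact row_eq_zero_of_leadingPositions hM ih (h i)

theorem finrank_le_sum_card_leadingPositions [Fintype ι] (A : Submodule F (Matrix ι κ F)) :
    finrank F A ≤ ∑ i, #(leadingPositions A i) := by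
  let f : A →ₗ[F] ∀ i, leadingPositions A i → F :=
    LinearMap.pi fun i => LinearMap.pi fun j =>
      Matrix.entryLinearMap F F i (j : κ) ∘ₗ A.subtype
  have hf : Function.Injective f := by
    refine (injective_iff_map_eq_zero f).2 fun M hM => Subtype.ext ?_
    exact eq_zero_of_leadingPositions M.2 fun i j hj => congrFun (congrFun hM i) ⟨j, hj⟩
  simpa [finrank_pi_fintype] using LinearMap.finrank_le_finrank_of_injective hf

theorem finrank_map_proj_le_card_leadingPositions {A : Submodule F (Matrix ι κ F)} {i : ι}
    (hi : IsMin i) : finrank F (A.map (LinearMap.proj i)) ≤ #(leadingPositions A i) := by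
  let f : A.map (LinearMap.proj i) →ₗ[F] leadingPositions A i → F :=
    LinearMap.pi fun j => LinearMap.proj (j : κ) ∘ₗ Submodule.subtype _
  have hf : Function.Injective f := by
    refine (injective_iff_map_eq_zero f).2 ?_
    rintro ⟨_, M, hM, rfl⟩ h
    exact Subtype.ext (row_eq_zero_of_leadingPositions hM
      (fun l hl => absurd hl hi.not_lt) fun j hj => congrFun h ⟨j, hj⟩)
  simpa using LinearMap.finrank_le_finrank_of_injective hf

theorem card_le_of_leadingPositions_of_rank_le {A : Submodule F (Matrix ι κ F)}
    {r : ℕ} (hr : ∀ M ∈ A, M.rank ≤ r) {S : Finset ι} {h : ι → κ} (hinj : Set.InjOn h S)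
    (hmem : ∀ i ∈ S, h i ∈ leadingPositions A i) : #S ≤ r := by
  simp only [mem_leadingPositions] at hmem
  choose! N hN hzero hlt hne using hmem
  obtain ⟨M, hMA, hM⟩ := exists_linearIndepOn_row hN hzero (linearIndepOn_of_leading hinj hne hlt)
  calc #S = (M.submatrix ((↑) : S → ι) id).rank := by
        rw [LinearIndependent.rank_matrix (M := M.submatrix ((↑) : S → ι) id) hM,
          Fintype.card_coe]
    _ ≤ M.rank := Matrix.rank_submatrix_le _ _ _
    _ ≤ r := hr M hMA

theorem exists_cover_leadingPositions [Fintype ι] {A : Submodule F (Matrix ι κ F)} {r : ℕ}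
    (hr : ∀ M ∈ A, M.rank ≤ r) :
    ∃ S : Finset ι, #(S.biUnion (leadingPositions A)) + #Sᶜ ≤ r ∧
      finrank F A ≤ #S * #(S.biUnion (leadingPositions A)) + #Sᶜ * Fintype.card κ := by
  obtain ⟨S, hS⟩ := exists_card_biUnion_add_card_compl_le (leadingPositions A)
    fun S h hinj hmem => card_le_of_leadingPositions_of_rank_le hr hinj hmem
  refine ⟨S, hS, (finrank_le_sum_card_leadingPositions A).trans ?_⟩
  rw [← Finset.sum_add_sum_compl S]
  exact Nat.add_le_add
    (Finset.sum_le_card_nsmul _ _ _ fun i hi =>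
      Finset.card_le_card (Finset.subset_biUnion_of_mem _ hi))
    (Finset.sum_le_card_nsmul _ _ _ fun i _ => Finset.card_le_univ _)

theorem finrank_le_card_mul [Fintype ι] (hcard : Fintype.card κ ≤ Fintype.card ι)
    {A : Submodule F (Matrix ι κ F)} {r : ℕ} (hr : ∀ M ∈ A, M.rank ≤ r) :
    finrank F A ≤ Fintype.card ι * r := by
  obtain ⟨S, hS, hA⟩ := exists_cover_leadingPositions hr
  calc finrank F A ≤ #S * #(S.biUnion (leadingPositions A)) + #Sᶜ * Fintype.card κ := hA
    _ ≤ Fintype.card ι * #(S.biUnion (leadingPositions A)) + #Sᶜ * Fintype.card ι := by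
      gcongr; exact Finset.card_le_univ S
    _ = Fintype.card ι * (#(S.biUnion (leadingPositions A)) + #Sᶜ) := by ring
    _ ≤ Fintype.card ι * r := Nat.mul_le_mul_left _ hS

theorem card_leadingPositions_le_or_eq_empty [Fintype ι]
    (hcard : Fintype.card κ ≤ Fintype.card ι) {A : Submodule F (Matrix ι κ F)} {r : ℕ}
    (hr : ∀ M ∈ A, M.rank ≤ r) (hdim : Fintype.card ι * r ≤ finrank F A) :
    (∀ i, #(leadingPositions A i) ≤ r) ∨
      ∃ T : Finset ι, #T = r ∧ ∀ i ∉ T, leadingPositions A i = ∅ := by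
  obtain ⟨S, hS, hA⟩ := exists_cover_leadingPositions hr
  have hsub : ∀ i ∈ S, leadingPositions A i ⊆ S.biUnion (leadingPositions A) :=
    fun i hi => Finset.subset_biUnion_of_mem _ hi
  have hcompl := S.card_add_card_compl
  set k := #(S.biUnion (leadingPositions A))
  set l := #Sᶜ
  rw [← hcompl] at hdim hcard
  rcases Nat.eq_zero_or_pos l with hl0 | hlpos
  · have hS_univ : S = Finset.univ := S.compl_eq_empty_iff.1 (Finset.card_eq_zero.1 hl0)
    refine Or.inl fun i => (Finset.card_le_card (hsub i ?_)).trans (by omega)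
    exact hS_univ ▸ Finset.mem_univ i
  · have hk0 : k = 0 := by nlinarith
    have hlr : l = r := by nlinarith
    refine Or.inr ⟨Sᶜ, hlr, fun i hi => ?_⟩
    exact Finset.subset_empty.1 (Finset.card_eq_zero.1 hk0 ▸ hsub i (by simpa using hi))

end LeadingPositions

section Dimension

variable {F E E' : Type*} [Field F] [AddCommGroup E] [Module F E] [AddCommGroup E'] [Module F E']

theorem finrank_le_finrank_inf_ker_add [FiniteDimensional F E] [FiniteDimensional F E']
    (U : Submodule F E) (φ : E →ₗ[F] E') :
    finrank F U ≤ finrank F ↥(U ⊓ LinearMap.ker φ) + finrank F E' := by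
  have hker : (LinearMap.ker (φ.domRestrict U)).map U.subtype = U ⊓ LinearMap.ker φ := by
    ext x
    simp [and_comm]
  have hrange := (φ.domRestrict U).finrank_range_add_finrank_ker
  have hle := (LinearMap.range (φ.domRestrict U)).finrank_le
  rw [← hker, Submodule.finrank_map_subtype_eq]
  omega

theorem exists_dual_finrank_inf_ker_lt {V : Submodule F E} [FiniteDimensional F V] {r : ℕ}
    (hr : 0 < r) (hV : finrank F V ≤ r) :
    ∃ φ : Dual F E, finrank F ↥(V ⊓ LinearMap.ker φ) < r := by
  rcases eq_or_ne V ⊥ with rfl | hne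
  · exact ⟨0, by rwa [bot_inf_eq, finrank_bot]⟩
  obtain ⟨v, hvV, hv⟩ := V.ne_bot_iff.1 hne
  obtain ⟨φ, hφ⟩ := Projective.exists_dual_ne_zero F hv
  have hlt : V ⊓ LinearMap.ker φ < V := inf_lt_left.2 fun h => hφ (h hvV)
  exact ⟨φ, (Submodule.finrank_lt_finrank_of_lt hlt).trans_le hV⟩

theorem finrank_quotient_ker_le [FiniteDimensional F E'] (φ : E →ₗ[F] E') :
    finrank F (E ⧸ LinearMap.ker φ) ≤ finrank F E' :=
  φ.quotKerEquivRange.finrank_eq.trans_le (LinearMap.range φ).finrank_le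

theorem finrank_pi_univ {ι : Type*} [Fintype ι] {V : ι → Type*} [∀ i, AddCommGroup (V i)]
    [∀ i, Module F (V i)] [∀ i, FiniteDimensional F (V i)] (A : ∀ i, Submodule F (V i)) :
    finrank F (Submodule.pi Set.univ A) = ∑ i, finrank F (A i) := by
  let f : (∀ i, A i) →ₗ[F] ∀ i, V i := LinearMap.pi fun i => (A i).subtype ∘ₗ LinearMap.proj i
  have hf : Function.Injective f := fun x y h => funext fun i => Subtype.ext (congrFun h i)
  have hrange : LinearMap.range f = Submodule.pi Set.univ A := by
    ext x
    exact ⟨by rintro ⟨y, rfl⟩ i -; exact (y i).2,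
      fun hx => ⟨fun i => ⟨x i, hx i (Set.mem_univ i)⟩, rfl⟩⟩
  rw [← hrange, LinearMap.finrank_range_of_inj hf, finrank_pi_fintype]

end Dimension

section ExtremalSpaces

variable {F ι κ : Type*} [Field F]

/-- If no row combination of a space `A` of dimension `|ι| * r` exceeds dimension `r`, then `A` is
the product of its row spaces, so the sum of all rows already takes all their values. -/
theorem exists_forall_row_mem [Fintype ι] [Finite κ] {A : Submodule F (Matrix ι κ F)} {r : ℕ}
    (hA : ∀ g : ι → F, finrank F (A.map (Matrix.vecMulBilin F F g)) ≤ r)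
    (hdim : Fintype.card ι * r ≤ finrank F A) :
    ∃ V : Submodule F (κ → F), finrank F V ≤ r ∧ ∀ M ∈ A, ∀ i, M i ∈ V := by
  classical
  let V (i : ι) : Submodule F (κ → F) := A.map (Matrix.vecMulBilin F F (Pi.single i 1))
  let P : Submodule F (Matrix ι κ F) := Submodule.pi Set.univ V
  have hrow (M : Matrix ι κ F) (hM : M ∈ A) (i : ι) : M i ∈ V i :=
    ⟨M, hM, Matrix.single_one_vecMul i M⟩
  have hAP : A = P := by
    refine Submodule.eq_of_le_of_finrank_le (fun M hM i _ => hrow M hM i) ?_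
    exact (finrank_pi_univ V).trans_le
      ((Finset.sum_le_card_nsmul _ _ r fun i _ => hA _).trans hdim)
  refine ⟨A.map (Matrix.vecMulBilin F F 1), hA 1, fun M hM i => ?_⟩
  have hsingle : Matrix.of (Pi.single i (M i)) ∈ A :=
    hAP ▸ Submodule.le_comap_single_pi V (hrow M hM i)
  refine ⟨Matrix.of (Pi.single i (M i)), hsingle, ?_⟩
  ext j
  simp [Matrix.vecMul, dotProduct, Pi.single_apply, ite_apply]

theorem exists_forall_col_mem [Finite ι] [Fintype κ] {A : Submodule F (Matrix ι κ F)} {r : ℕ}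
    (hA : ∀ h : κ → F, finrank F (A.map ((Matrix.mulVecBilin F F).flip h)) ≤ r)
    (hdim : Fintype.card κ * r ≤ finrank F A) :
    ∃ W : Submodule F (ι → F), finrank F W ≤ r ∧ ∀ M ∈ A, ∀ j, M.col j ∈ W := by
  let e := Matrix.transposeLinearEquiv ι κ F F
  have hmap (h : κ → F) : (A.map e.toLinearMap).map (Matrix.vecMulBilin F F h) =
      A.map ((Matrix.mulVecBilin F F).flip h) := by
    rw [← Submodule.map_comp]
    congr 1
    ext M : 1
    exact Matrix.vecMul_transpose M h
  obtain ⟨W, hW, hmem⟩ := exists_forall_row_mem (A := A.map e.toLinearMap)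
    (fun h => hmap h ▸ hA h) (hdim.trans_eq (LinearEquiv.finrank_map_eq e A).symm)
  exact ⟨W, hW, fun M hM j => hmem _ (Submodule.mem_map_of_mem hM) j⟩

variable [Fintype κ]

theorem row_mem_span_of_rank_le [Finite ι] {T : Finset ι} {M : Matrix ι κ F} (hM : M.rank ≤ #T)
    (hli : LinearIndependent F fun i : T => M i) (i : ι) :
    M i ∈ Submodule.span F (Set.range fun i : T => M i) := by
  cases nonempty_fintype ι
  have hle : Submodule.span F (Set.range fun i : T => M i) ≤
      Submodule.span F (Set.range M.row) :=
    Submodule.span_mono (Set.range_comp_subset_range ((↑) : T → ι) M.row)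
  rw [Submodule.eq_of_le_of_finrank_le hle]
  · exact Submodule.subset_span ⟨i, rfl⟩
  · rwa [finrank_span_eq_card hli, Fintype.card_coe, ← Matrix.rank_eq_finrank_span_row]

/-- If the rows in `T` may be prescribed freely and determine the matrix, then `M *ᵥ h` is
determined by its entries in `T`: a matrix whose rows in `T` form an independent tuple in the
hyperplane orthogonal to `h` has all its rows in this hyperplane, and these tuples span. -/
theorem mulVec_eq_zero_of_forall_mem [Finite ι] {A : Submodule F (Matrix ι κ F)} {T : Finset ι}
    (hr : ∀ M ∈ A, M.rank ≤ #T) (hT : #T < Fintype.card κ) (e : A ≃ₗ[F] (T → κ → F))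
    (he : ∀ (M : A) (i : T), e M i = M.1 i) {M : Matrix ι κ F} (hM : M ∈ A) {h : κ → F}
    (hMh : ∀ i ∈ T, (M *ᵥ h) i = 0) : M *ᵥ h = 0 := by
  let H : Submodule F (κ → F) := LinearMap.ker ((dotProductBilin F F).flip h)
  have hH : #T ≤ finrank F H := by
    have := finrank_le_finrank_inf_ker_add ⊤ ((dotProductBilin F F).flip h)
    rw [top_inf_eq, finrank_top, finrank_self, finrank_fintype_fun_eq_card] at this
    exact Nat.le_of_lt_succ (hT.trans_le this)
  let L : (T → H) →ₗ[F] ι → F := (Matrix.mulVecBilin F F).flip h ∘ₗ A.subtype ∘ₗ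
    e.symm.toLinearMap ∘ₗ H.subtype.compLeft T
  have hL : L = 0 := by
    refine eq_zero_of_forall_linearIndependent (by simpa using hH) L fun y hy => ?_
    let N : A := e.symm (H.subtype ∘ y)
    have hrows : (fun i : T => N.1 i) = H.subtype ∘ y := by
      funext i
      rw [← he, e.apply_symm_apply]
    have hspan_le : Submodule.span F (Set.range (H.subtype ∘ y)) ≤ H := by
      rw [Submodule.span_le]
      rintro _ ⟨i, rfl⟩
      exact (y i).2
    have hNH (i : ι) : N.1 i ∈ H := hspan_le <| hrows ▸
      row_mem_span_of_rank_le (hr N N.2) (hrows ▸ hy.map' H.subtype H.ker_subtype) i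
    exact funext hNH
  have hMe : e.symm (H.subtype ∘ fun i : T => ⟨M i, hMh i i.2⟩) = ⟨M, hM⟩ :=
    e.symm_apply_eq.2 (funext fun i => (he ⟨M, hM⟩ i).symm)
  have hLM := LinearMap.congr_fun hL fun i : T => ⟨M i, hMh i i.2⟩
  exact (congrArg (fun N : A => N.1 *ᵥ h) hMe).symm.trans hLM

end ExtremalSpaces

section RowAndColumnSpaces

variable {F ι κ : Type*} [Field F] [Fintype κ]

theorem finrank_map_mulVec_le_card [Finite ι] {A : Submodule F (Matrix ι κ F)} {T : Finset ι}
    (hr : ∀ M ∈ A, M.rank ≤ #T) (hT : #T < Fintype.card κ) (e : A ≃ₗ[F] (T → κ → F))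
    (he : ∀ (M : A) (i : T), e M i = M.1 i) (h : κ → F) :
    finrank F (A.map ((Matrix.mulVecBilin F F).flip h)) ≤ #T := by
  let f : A.map ((Matrix.mulVecBilin F F).flip h) →ₗ[F] T → F :=
    LinearMap.funLeft F F ((↑) : T → ι) ∘ₗ Submodule.subtype _
  have hf : Function.Injective f := by
    refine (injective_iff_map_eq_zero f).2 ?_
    rintro ⟨_, M, hM, rfl⟩ hMh
    exact Subtype.ext (mulVec_eq_zero_of_forall_mem hr hT e he hM
      fun i hi => congrFun hMh ⟨i, hi⟩)
  simpa using LinearMap.finrank_le_finrank_of_injective hf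

theorem rank_le_finrank_of_row_mem [Finite ι] {V : Submodule F (κ → F)}
    {M : Matrix ι κ F} (hM : ∀ i, M i ∈ V) : M.rank ≤ finrank F V := by
  cases nonempty_fintype ι
  rw [Matrix.rank_eq_finrank_span_row]
  exact Submodule.finrank_mono (Submodule.span_le.2 (Set.range_subset_iff.2 hM))

variable [Fintype ι]

theorem exists_linearEquiv_restrict_rows [LinearOrder ι] [LinearOrder κ]
    (hcard : Fintype.card κ ≤ Fintype.card ι) {A : Submodule F (Matrix ι κ F)} {T : Finset ι}
    (hT : ∀ i ∉ T, leadingPositions A i = ∅) (hdim : Fintype.card ι * #T ≤ finrank F A) :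
    ∃ e : A ≃ₗ[F] (T → κ → F), ∀ (M : A) (i : T), e M i = M.1 i := by
  let f : A →ₗ[F] T → κ → F := LinearMap.pi fun i => LinearMap.proj (i : ι) ∘ₗ A.subtype
  have hf : Function.Injective f := by
    refine (injective_iff_map_eq_zero f).2 fun M hM => Subtype.ext ?_
    refine eq_zero_of_leadingPositions M.2 fun i j hj => ?_
    have hi : i ∈ T := by
      by_contra hi
      simp [hT i hi] at hj
    exact congrFun (congrFun hM ⟨i, hi⟩) j
  have hle : finrank F (T → κ → F) ≤ finrank F A := by
    refine le_trans ?_ hdim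
    simpa [finrank_pi_fintype, mul_comm] using Nat.mul_le_mul_left #T hcard
  have hfinrank := (LinearMap.finrank_le_finrank_of_injective hf).antisymm hle
  exact ⟨f.linearEquivOfInjective hf hfinrank, fun _ _ => rfl⟩

theorem exists_isUnit_row_eq [DecidableEq ι] {g : ι → F} (hg : g ≠ 0) (i : ι) :
    ∃ P : Matrix ι ι F, IsUnit P ∧ P i = g := by
  obtain ⟨P, hP, rfl⟩ := exists_linearIndependent_apply_eq (F := F) (E := ι → F) (by simp) i hg
  exact ⟨P, Matrix.linearIndependent_rows_iff_isUnit.1 hP, rfl⟩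

variable [LinearOrder ι] [LinearOrder κ]

/-- As the row `i` has more than `r` leading positions, the space is determined by `r` of its rows,
and so are the vectors `M *ᵥ h`. -/
theorem finrank_map_mulVec_le_of_lt_finrank_map_proj (hcard : Fintype.card κ ≤ Fintype.card ι)
    {A : Submodule F (Matrix ι κ F)} {r : ℕ} (hr : ∀ M ∈ A, M.rank ≤ r)
    (hrκ : r < Fintype.card κ) (hdim : Fintype.card ι * r ≤ finrank F A) {i : ι} (hi : IsMin i)
    (hrow : r < finrank F (A.map (LinearMap.proj i))) (h : κ → F) :
    finrank F (A.map ((Matrix.mulVecBilin F F).flip h)) ≤ r := by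
  rcases card_leadingPositions_le_or_eq_empty hcard hr hdim with hle | ⟨T, rfl, hT⟩
  · have hlead := finrank_map_proj_le_card_leadingPositions (A := A) hi
    exact absurd (hrow.trans_le (hlead.trans (hle i))) (lt_irrefl r)
  · obtain ⟨e, he⟩ := exists_linearEquiv_restrict_rows hcard hT hdim
    exact finrank_map_mulVec_le_card hr hrκ e he h

/-- After a change of basis of the row space, `g ᵥ* M` becomes the first row of `M`. -/
theorem finrank_map_mulVec_le_of_lt_finrank_map_vecMul (hcard : Fintype.card κ ≤ Fintype.card ι)
    {A : Submodule F (Matrix ι κ F)} {r : ℕ} (hr : ∀ M ∈ A, M.rank ≤ r)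
    (hrκ : r < Fintype.card κ) (hdim : Fintype.card ι * r ≤ finrank F A) {g : ι → F}
    (hg : r < finrank F (A.map (Matrix.vecMulBilin F F g))) (h : κ → F) :
    finrank F (A.map ((Matrix.mulVecBilin F F).flip h)) ≤ r := by
  have hι : Nonempty ι := Fintype.card_pos_iff.1 (by omega)
  obtain ⟨i, hi⟩ := Finite.exists_min (id : ι → ι)
  obtain ⟨P, hP, rfl⟩ : ∃ P : Matrix ι ι F, IsUnit P ∧ P i = g := by
    refine exists_isUnit_row_eq ?_ i
    rintro rfl
    rw [map_zero, Submodule.map_zero, finrank_bot] at hg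
    exact absurd hg (Nat.not_lt_zero r)
  let e := mulLeftLinearMap κ F P
  have he : Function.Injective e :=
    Function.LeftInverse.injective (g := (P⁻¹ * ·)) fun M =>
      P.nonsing_inv_mul_cancel_left M (P.isUnit_iff_isUnit_det.1 hP)
  have hrank : ∀ M ∈ A.map e, M.rank ≤ r := by
    rintro _ ⟨M, hM, rfl⟩
    exact (Matrix.rank_mul_le_right P M).trans (hr M hM)
  have hrow : (A.map e).map (LinearMap.proj i) = A.map (Matrix.vecMulBilin F F (P i)) := by
    ext x
    constructor
    · rintro ⟨_, ⟨M, hM, rfl⟩, rfl⟩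
      exact ⟨M, hM, rfl⟩
    · rintro ⟨M, hM, rfl⟩
      exact ⟨P * M, ⟨M, hM, rfl⟩, rfl⟩
  have hcol : (A.map e).map ((Matrix.mulVecBilin F F).flip h) =
      (A.map ((Matrix.mulVecBilin F F).flip h)).map P.mulVecLin := by
    rw [← Submodule.map_comp, ← Submodule.map_comp]
    congr 1
    ext M : 1
    exact (Matrix.mulVec_mulVec h P M).symm
  have hPinj : Function.Injective P.mulVecLin := Matrix.mulVec_injective_of_isUnit hP
  rw [(A.equivMapOfInjective e he).finrank_eq] at hdim
  rw [← hrow] at hg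
  rw [(Submodule.equivMapOfInjective _ hPinj _).finrank_eq, ← hcol]
  exact finrank_map_mulVec_le_of_lt_finrank_map_proj hcard hrank hrκ hdim (fun l _ => hi l) hg h

theorem exists_forall_row_mem_or_exists_forall_col_mem
    (hcard : Fintype.card κ ≤ Fintype.card ι) {A : Submodule F (Matrix ι κ F)} {r : ℕ}
    (hr : ∀ M ∈ A, M.rank ≤ r) (hdim : Fintype.card ι * r ≤ finrank F A) :
    (∃ V : Submodule F (κ → F), finrank F V ≤ r ∧ ∀ M ∈ A, ∀ i, M i ∈ V) ∨
      ∃ W : Submodule F (ι → F), finrank F W ≤ r ∧ ∀ M ∈ A, ∀ j, M.col j ∈ W := by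
  by_cases hrκ : Fintype.card κ ≤ r
  · exact Or.inl ⟨⊤, by simpa using hrκ, fun _ _ _ => Submodule.mem_top⟩
  by_cases! hg : ∀ g : ι → F, finrank F (A.map (Matrix.vecMulBilin F F g)) ≤ r
  · exact Or.inl (exists_forall_row_mem hg hdim)
  · obtain ⟨g, hg⟩ := hg
    refine Or.inr (exists_forall_col_mem
      (finrank_map_mulVec_le_of_lt_finrank_map_vecMul hcard hr (not_le.1 hrκ) hdim hg) ?_)
    exact (Nat.mul_le_mul_right r hcard).trans hdim

theorem exists_finrank_quotient_le_rank_lt (hcard : Fintype.card κ ≤ Fintype.card ι)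
    {A : Submodule F (Matrix ι κ F)} {r : ℕ} (hr0 : 0 < r) (hr : ∀ M ∈ A, M.rank ≤ r)
    (hdim : Fintype.card ι * r ≤ finrank F A) :
    ∃ K : Submodule F (Matrix ι κ F), finrank F (Matrix ι κ F ⧸ K) ≤ Fintype.card ι ∧
      ∀ M ∈ A ⊓ K, M.rank < r := by
  rcases exists_forall_row_mem_or_exists_forall_col_mem hcard hr hdim with
    ⟨V, hVr, hV⟩ | ⟨W, hWr, hW⟩
  · obtain ⟨φ, hφ⟩ := exists_dual_finrank_inf_ker_lt hr0 hVr
    let f : Matrix ι κ F →ₗ[F] ι → F := φ.compLeft ι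
    refine ⟨LinearMap.ker f, (finrank_quotient_ker_le f).trans_eq (by simp), fun M hM => ?_⟩
    exact (rank_le_finrank_of_row_mem (V := V ⊓ LinearMap.ker φ) fun i =>
      ⟨hV M hM.1 i, congrFun hM.2 i⟩).trans_lt hφ
  · obtain ⟨φ, hφ⟩ := exists_dual_finrank_inf_ker_lt hr0 hWr
    let f : Matrix ι κ F →ₗ[F] κ → F :=
      φ.compLeft κ ∘ₗ (Matrix.transposeLinearEquiv ι κ F F).toLinearMap
    refine ⟨LinearMap.ker f, (finrank_quotient_ker_le f).trans (by simpa using hcard),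
      fun M hM => ?_⟩
    rw [← Matrix.rank_transpose]
    exact (rank_le_finrank_of_row_mem (V := W ⊓ LinearMap.ker φ) fun j =>
      ⟨hW M hM.1 j, congrFun hM.2 j⟩).trans_lt hφ

end RowAndColumnSpaces

section Anticodes

variable {F : Type*} [Field F] {a b : ℕ}

theorem bddAbove_ranks (A : Submodule F (Matrix (Fin a) (Fin b) F)) :
    BddAbove {w | ∃ X ∈ A, X.rank = w} :=
  ⟨b, by
    rintro _ ⟨X, -, rfl⟩
    exact X.rank_le_width⟩

theorem rank_le_maxRank {A : Submodule F (Matrix (Fin a) (Fin b) F)}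
    {X : Matrix (Fin a) (Fin b) F} (hX : X ∈ A) : X.rank ≤ maxRank A :=
  le_csSup (bddAbove_ranks A) ⟨X, hX, rfl⟩

theorem exists_rank_eq_maxRank (A : Submodule F (Matrix (Fin a) (Fin b) F)) :
    ∃ X ∈ A, X.rank = maxRank A :=
  Nat.sSup_mem (s := {w | ∃ X ∈ A, X.rank = w}) ⟨_, 0, A.zero_mem, rfl⟩ (bddAbove_ranks A)

theorem maxRank_le {A : Submodule F (Matrix (Fin a) (Fin b) F)} {r : ℕ}
    (h : ∀ X ∈ A, X.rank ≤ r) : maxRank A ≤ r := by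
  obtain ⟨X, hX, hr⟩ := exists_rank_eq_maxRank A
  exact hr ▸ h X hX

theorem isOptimalAnticode_of_le_finrank (hba : b ≤ a)
    {A : Submodule F (Matrix (Fin a) (Fin b) F)} {r : ℕ} (h : ∀ X ∈ A, X.rank ≤ r)
    (hdim : a * r ≤ finrank F A) : IsOptimalAnticode A := by
  refine le_antisymm ?_ ((Nat.mul_le_mul_left a (maxRank_le h)).trans hdim)
  simpa using finrank_le_card_mul (by simpa using hba) fun X hX => rank_le_maxRank (A := A) hX

theorem IsOptimalAnticode.exists_inf_maxRank_lt (hba : b ≤ a)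
    {A : Submodule F (Matrix (Fin a) (Fin b) F)} (hA : IsOptimalAnticode A)
    (hr : 0 < maxRank A) :
    ∃ K : Submodule F (Matrix (Fin a) (Fin b) F),
      finrank F (Matrix (Fin a) (Fin b) F ⧸ K) ≤ a ∧
        IsOptimalAnticode (A ⊓ K) ∧ maxRank (A ⊓ K) < maxRank A := by
  obtain ⟨K, hK, hlt⟩ := exists_finrank_quotient_le_rank_lt (by simpa using hba) hr
    (fun X hX => rank_le_maxRank hX) (by simpa using hA.ge)
  rw [Fintype.card_fin] at hK
  have hrank : ∀ X ∈ A ⊓ K, X.rank ≤ maxRank A - 1 := fun X hX => Nat.le_sub_one_of_lt (hlt X hX)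
  refine ⟨K, hK, isOptimalAnticode_of_le_finrank hba hrank ?_,
    (maxRank_le hrank).trans_lt (Nat.sub_one_lt hr.ne')⟩
  have hker := finrank_le_finrank_inf_ker_add A K.mkQ
  rw [K.ker_mkQ, show finrank F A = a * maxRank A from hA] at hker
  rw [Nat.mul_sub_one]
  omega

/-- The vectors of `F ^ b` whose coordinates in positions `≥ s` vanish. -/
def firstCoords (F : Type*) [Field F] (b s : ℕ) : Submodule F (Fin b → F) :=
  Submodule.pi {j | s ≤ (j : ℕ)} fun _ => ⊥

theorem finrank_firstCoords (s : ℕ) : finrank F (firstCoords F b s) = min b s := by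
  let I : Set (Fin b) := {j | (j : ℕ) < s}
  let J : Set (Fin b) := {j | s ≤ (j : ℕ)}
  have hIJ : Disjoint I J := Set.disjoint_left.2 fun j (hjI : (j : ℕ) < s) (hjJ : s ≤ (j : ℕ)) =>
    hjI.not_ge hjJ
  have hker : firstCoords F b s = ⨅ j ∈ J, LinearMap.ker (LinearMap.proj j) := by
    ext v
    simp [firstCoords, J, Submodule.mem_pi]
  rw [hker, (LinearMap.iInfKerProjEquiv F (fun _ : Fin b => F) hIJ
    fun j _ => lt_or_ge (j : ℕ) s).finrank_eq]
  simp [I, Fintype.card_subtype, Fin.card_filter_val_lt]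

/-- The anticode of the `a × b` matrices whose columns in positions `≥ s` vanish. -/
def colAnticode (F : Type*) [Field F] (a b s : ℕ) : Submodule F (Matrix (Fin a) (Fin b) F) :=
  Submodule.pi Set.univ fun _ => firstCoords F b s

theorem colAnticode_mono : Monotone (colAnticode F a b) :=
  fun _ _ h _ hX i hi j hj => hX i hi j (h.trans hj)

theorem rank_le_of_mem_colAnticode {s : ℕ} {X : Matrix (Fin a) (Fin b) F}
    (hX : X ∈ colAnticode F a b s) : X.rank ≤ min b s :=
  finrank_firstCoords (F := F) (b := b) s ▸
    rank_le_finrank_of_row_mem fun i => hX i (Set.mem_univ i)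

theorem finrank_colAnticode (s : ℕ) : finrank F (colAnticode F a b s) = a * min b s := by
  refine (finrank_pi_univ fun _ : Fin a => firstCoords F b s).trans ?_
  simp [finrank_firstCoords]

theorem isOptimalAnticode_colAnticode (hba : b ≤ a) (s : ℕ) :
    IsOptimalAnticode (colAnticode F a b s) :=
  isOptimalAnticode_of_le_finrank hba (fun _ hX => rank_le_of_mem_colAnticode hX)
    (finrank_colAnticode s).ge

end Anticodes

section Weights

variable {F : Type*} [Field F] {t : ℕ} {m n : Fin t → ℕ}

theorem minDist_le_srk {C : Code F m n} {X : Ambient F m n} (hX : X ∈ C) (h0 : X ≠ 0) :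
    minDist C ≤ srk X :=
  Nat.sInf_le ⟨X, hX, h0, rfl⟩

theorem srk_le_sum_maxRank {A : ∀ i : Fin t, Submodule F (Matrix (Fin (m i)) (Fin (n i)) F)}
    {X : Ambient F m n} (hX : X ∈ Submodule.pi Set.univ A) : srk X ≤ ∑ i, maxRank (A i) :=
  Finset.sum_le_sum fun i _ => rank_le_maxRank (hX i (Set.mem_univ i))

theorem maxSrk_pi (A : ∀ i : Fin t, Submodule F (Matrix (Fin (m i)) (Fin (n i)) F)) :
    maxSrk (m := m) (n := n) (Submodule.pi Set.univ A) = ∑ i, maxRank (A i) := by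
  choose X hX hXr using fun i => exists_rank_eq_maxRank (A i)
  refine IsGreatest.csSup_eq
    ⟨⟨X, fun i _ => hX i, Finset.sum_congr rfl fun i _ => hXr i⟩, ?_⟩
  rintro _ ⟨Y, hY, rfl⟩
  exact srk_le_sum_maxRank hY

theorem wt_le {U : Code F m n} {A : ∀ i : Fin t, Submodule F (Matrix (Fin (m i)) (Fin (n i)) F)}
    (hA : ∀ i, IsOptimalAnticode (A i)) (hU : U ≤ Submodule.pi Set.univ A) :
    wt U ≤ ∑ i, maxRank (A i) :=
  Nat.sInf_le ⟨A, hA, hU, maxSrk_pi A⟩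

theorem exists_anticode_wt (hmn : ∀ i, n i ≤ m i) (U : Code F m n) :
    ∃ A : ∀ i : Fin t, Submodule F (Matrix (Fin (m i)) (Fin (n i)) F),
      (∀ i, IsOptimalAnticode (A i)) ∧ U ≤ Submodule.pi Set.univ A ∧
        ∑ i, maxRank (A i) = wt U := by
  have hne : {w | ∃ A : ∀ i : Fin t, Submodule F (Matrix (Fin (m i)) (Fin (n i)) F),
      (∀ i, IsOptimalAnticode (A i)) ∧ U ≤ Submodule.pi Set.univ A ∧
        maxSrk (m := m) (n := n) (Submodule.pi Set.univ A) = w}.Nonempty :=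
    ⟨_, fun i => colAnticode F (m i) (n i) (n i),
      fun i => isOptimalAnticode_colAnticode (hmn i) (n i),
      fun X _ i _ k _ j hj => absurd j.2 (not_lt.2 hj), rfl⟩
  obtain ⟨A, hA, hU, hw⟩ := Nat.sInf_mem hne
  exact ⟨A, hA, hU, by rw [← maxSrk_pi, hw, wt]⟩

theorem srk_le_wt (hmn : ∀ i, n i ≤ m i) {U : Code F m n} {X : Ambient F m n} (hX : X ∈ U) :
    srk X ≤ wt U := by
  obtain ⟨A, -, hU, hw⟩ := exists_anticode_wt hmn U
  exact hw ▸ srk_le_sum_maxRank (hU hX)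

theorem genWeight_le {C U : Code F m n} {r : ℕ} (hU : U ≤ C) (hr : r ≤ finrank F U) :
    genWeight C r ≤ wt U :=
  Nat.sInf_le ⟨U, hU, hr, rfl⟩

theorem exists_wt_eq_genWeight {C : Code F m n} {r : ℕ} (hr : r ≤ finrank F C) :
    ∃ U ≤ C, r ≤ finrank F U ∧ wt U = genWeight C r := by
  have hne : {w | ∃ U : Code F m n, U ≤ C ∧ r ≤ finrank F U ∧ wt U = w}.Nonempty :=
    ⟨_, C, le_rfl, hr, rfl⟩
  exact Nat.sInf_mem hne

theorem genWeight_mono (C : Code F m n) {r s : ℕ} (hrs : r ≤ s) (hs : s ≤ finrank F C) :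
    genWeight C r ≤ genWeight C s := by
  obtain ⟨U, hU, hsU, hw⟩ := exists_wt_eq_genWeight hs
  exact hw ▸ genWeight_le hU (hrs.trans hsU)

theorem minDist_le_genWeight (hmn : ∀ i, n i ≤ m i) {C D : Code F m n} (hCD : C ≤ D) {r : ℕ}
    (hr0 : 0 < r) (hr : r ≤ finrank F C) : minDist D ≤ genWeight C r := by
  obtain ⟨U, hU, hrU, hw⟩ := exists_wt_eq_genWeight hr
  obtain ⟨X, hX, hX0⟩ := U.ne_bot_iff.1 fun h => by
    rw [h, finrank_bot] at hrU
    omega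
  exact hw ▸ (minDist_le_srk (hCD (hU hX)) hX0).trans (srk_le_wt hmn hX)

theorem isGreedySubcode_of_chain {C : Code F m n} (U : ℕ → Code F m n) {k : ℕ}
    (hUC : ∀ r ≤ k, U r ≤ C) (hmono : ∀ r < k, U r ≤ U (r + 1))
    (hdim : ∀ r ≤ k, finrank F (U r) = r)
    (hwt : ∀ r, 1 ≤ r → r ≤ k → wt (U r) = genWeight C r) :
    ∀ r, 1 ≤ r → r ≤ k → IsGreedySubcode C r (U r)
  | 0, h, _ => absurd h (Nat.not_succ_le_zero 0)
  | 1, _, hk => ⟨hUC 1 hk, hdim 1 hk, hwt 1 le_rfl hk⟩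
  | r + 2, _, hk => by
    refine ⟨⟨hUC _ hk, hdim _ hk, U (r + 1), hmono _ hk,
      isGreedySubcode_of_chain U hUC hmono hdim hwt (r + 1) (by omega) (by omega)⟩, ?_⟩
    rintro U' ⟨hU', hdim', -⟩
    rw [hwt _ (by omega) hk]
    exact genWeight_le hU' hdim'.ge

end Weights

section Columns

variable {t : ℕ}

/-- The number of columns of the `i`-th block among the first `w` columns of the blocks of widths
`n`, listed one after the other. -/
def prefixCols (n : Fin t → ℕ) (w : ℕ) (i : Fin t) : ℕ := min (n i) (w - ∑ l ∈ Finset.Iio i, n l)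

/-- The number of entries of a tuple of `m i × n i` matrices in its first `w` columns. -/
def prefixDim (m n : Fin t → ℕ) (w : ℕ) : ℕ := ∑ i, m i * prefixCols n w i

/-- The height of the `w`-th column of a tuple of `m i × n i` matrices, where columns are counted
from `1`. -/
def blockHeight (m n : Fin t → ℕ) (w : ℕ) : ℕ := prefixDim m n w - prefixDim m n (w - 1)

variable {m n : Fin t → ℕ}

theorem prefixCols_mono (n : Fin t → ℕ) (i : Fin t) : Monotone (prefixCols n · i) :=
  fun _ _ h => min_le_min_left _ (Nat.sub_le_sub_right h _)

theorem prefixDim_mono (m n : Fin t → ℕ) : Monotone (prefixDim m n) :=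
  fun _ _ h => Finset.sum_le_sum fun i _ => Nat.mul_le_mul_left _ (prefixCols_mono n i h)

theorem sum_Iio_add_sum_Ici (g : Fin t → ℕ) (j : Fin t) :
    ∑ i ∈ Finset.Iio j, g i + ∑ i ∈ Finset.Ici j, g i = ∑ i, g i := by
  rw [← Finset.sum_filter_add_sum_filter_not Finset.univ (· < j)]
  congr 2 <;> ext i <;> simp

theorem sum_Iio_add_le_sum (n : Fin t → ℕ) (i : Fin t) :
    ∑ l ∈ Finset.Iio i, n l + n i ≤ ∑ l, n l := by
  rw [← sum_Iio_add_sum_Ici n i]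
  exact Nat.add_le_add_left (Finset.single_le_sum_of_canonicallyOrdered (by simp)) _

theorem sum_Iio_add_le_sum_Iio {i j : Fin t} (h : i < j) :
    ∑ l ∈ Finset.Iio i, n l + n i ≤ ∑ l ∈ Finset.Iio j, n l := by
  rw [add_comm, ← Finset.sum_insert (s := Finset.Iio i) (a := i) (by simp), Finset.Iio_insert]
  exact Finset.sum_le_sum_of_subset fun l hl =>
    Finset.mem_Iio.2 ((Finset.mem_Iic.1 hl).trans_lt h)

theorem sum_mul_prefixCols (g : Fin t → ℕ) {j : Fin t} {δ : ℕ} (hδ : δ ≤ n j) :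
    ∑ i, g i * prefixCols n (∑ l ∈ Finset.Iio j, n l + δ) i =
      ∑ i ∈ Finset.Iio j, g i * n i + g j * δ := by
  rw [← sum_Iio_add_sum_Ici _ j]
  congr 1
  · refine Finset.sum_congr rfl fun i hi => ?_
    have := sum_Iio_add_le_sum_Iio (n := n) (Finset.mem_Iio.1 hi)
    rw [prefixCols, min_eq_left (by omega)]
  · rw [Finset.sum_eq_single_of_mem j (Finset.mem_Ici.2 le_rfl)]
    · rw [prefixCols, Nat.add_sub_cancel_left, min_eq_right hδ]
    · intro i hi hij
      have := sum_Iio_add_le_sum_Iio (n := n) (lt_of_le_of_ne' (Finset.mem_Ici.1 hi) hij)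
      rw [prefixCols, Nat.sub_eq_zero_of_le (by omega), Nat.min_zero, mul_zero]

theorem exists_eq_sum_Iio_add {w : ℕ} (hw : 0 < w) (hwn : w ≤ ∑ i, n i) :
    ∃ (j : Fin t) (δ : ℕ), δ < n j ∧ w = ∑ l ∈ Finset.Iio j, n l + δ + 1 := by
  obtain ⟨⟨j, δ⟩, hjδ⟩ := finSigmaFinEquiv.surjective (⟨w - 1, by omega⟩ : Fin (∑ i, n i))
  refine ⟨j, δ, δ.2, ?_⟩
  have hsum : ∑ i : Fin j, n (Fin.castLE j.2.le i) = ∑ l ∈ Finset.Iio j, n l := by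
    refine Finset.sum_bij' (fun i _ => Fin.castLE j.2.le i)
      (fun (l : Fin t) hl => ⟨l, Fin.lt_def.1 (Finset.mem_Iio.1 hl)⟩)
      (fun i _ => Finset.mem_Iio.2 i.2) ?_ ?_ ?_ ?_ <;> simp
  have hval := congrArg Fin.val hjδ
  rw [finSigmaFinEquiv_apply, hsum] at hval
  simp only at hval
  omega

theorem blockHeight_sum_Iio_add {j : Fin t} {δ : ℕ} (hδ : δ < n j) :
    blockHeight m n (∑ l ∈ Finset.Iio j, n l + δ + 1) = m j := by
  rw [blockHeight, Nat.add_sub_cancel, prefixDim, prefixDim, add_assoc, sum_mul_prefixCols m hδ,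
    sum_mul_prefixCols m hδ.le, Nat.mul_succ, ← add_assoc, Nat.add_sub_cancel_left]

theorem prefixCols_sum (i : Fin t) : prefixCols n (∑ l, n l) i = n i := by
  have := sum_Iio_add_le_sum n i
  rw [prefixCols, min_eq_left (by omega)]

theorem sum_prefixCols {w : ℕ} (hwn : w ≤ ∑ i, n i) : ∑ i, prefixCols n w i = w := by
  rcases Nat.eq_zero_or_pos w with rfl | hw
  · simp [prefixCols]
  obtain ⟨j, δ, hδ, rfl⟩ := exists_eq_sum_Iio_add hw hwn
  simpa [add_assoc] using sum_mul_prefixCols 1 (n := n) (Nat.succ_le_of_lt hδ)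

end Columns

section Codes

variable {F : Type*} [Field F] {t : ℕ} {m n : Fin t → ℕ}

/-- The code of the tuples of matrices supported on the first `w` columns. -/
def prefixCode (F : Type*) [Field F] {t : ℕ} (m n : Fin t → ℕ) (w : ℕ) : Code F m n :=
  Submodule.pi Set.univ fun i => colAnticode F (m i) (n i) (prefixCols n w i)

theorem prefixCode_mono : Monotone (prefixCode F m n) :=
  fun _ _ h _ hX i hi => colAnticode_mono (prefixCols_mono n i h) (hX i hi)

theorem srk_le_of_mem_prefixCode {w : ℕ} (hw : w ≤ ∑ i, n i) {X : Ambient F m n}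
    (hX : X ∈ prefixCode F m n w) : srk X ≤ w :=
  (Finset.sum_le_sum fun i _ => (rank_le_of_mem_colAnticode (hX i (Set.mem_univ i))).trans
    (min_le_right _ _)).trans (sum_prefixCols hw).le

theorem finrank_prefixCode (w : ℕ) : finrank F (prefixCode F m n w) = prefixDim m n w := by
  refine (finrank_pi_univ _).trans (Finset.sum_congr rfl fun i _ => ?_)
  rw [finrank_colAnticode, min_eq_right (b := prefixCols n w i) (min_le_left _ _)]

theorem wt_le_of_le_prefixCode (hmn : ∀ i, n i ≤ m i) {w : ℕ} (hw : w ≤ ∑ i, n i)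
    {U : Code F m n} (hU : U ≤ prefixCode F m n w) : wt U ≤ w :=
  (wt_le (fun i => isOptimalAnticode_colAnticode (hmn i) _) hU).trans
    ((Finset.sum_le_sum fun _ _ => maxRank_le fun _ hX =>
      (rank_le_of_mem_colAnticode hX).trans (min_le_right _ _)).trans (sum_prefixCols hw).le)

theorem prefixCode_sum : prefixCode F m n (∑ i, n i) = ⊤ := by
  refine eq_top_iff.2 fun X _ i _ k _ j hj => ?_
  rw [prefixCols_sum] at hj
  exact absurd j.2 (not_lt.2 hj)

theorem wt_le_sum (hmn : ∀ i, n i ≤ m i) (U : Code F m n) : wt U ≤ ∑ i, n i :=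
  wt_le_of_le_prefixCode hmn le_rfl (prefixCode_sum (F := F) (m := m) (n := n) ▸ le_top)

theorem finrank_ambient : finrank F (Ambient F m n) = prefixDim m n (∑ i, n i) := by
  rw [← finrank_prefixCode (F := F), prefixCode_sum, finrank_top]

theorem IsMSRD.finrank_add_prefixDim {C : Code F m n} (hC : IsMSRD C) :
    finrank F C + prefixDim m n (minDist C - 1) = prefixDim m n (∑ i, n i) := by
  obtain ⟨j, δ, hδ, hd, hdim⟩ := hC
  have hsum : prefixDim m n (∑ i, n i) = ∑ i, m i * n i :=
    Finset.sum_congr rfl fun i _ => by rw [prefixCols_sum]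
  rw [hsum, hd, Nat.add_sub_cancel, prefixDim, sum_mul_prefixCols m hδ.le,
    ← sum_Iio_add_sum_Ici _ j, ← hdim]
  ring

theorem IsMSRD.minDist_pos {C : Code F m n} (hC : IsMSRD C) : 0 < minDist C := by
  obtain ⟨j, δ, -, hd, -⟩ := hC
  omega

theorem IsMSRD.minDist_le {C : Code F m n} (hC : IsMSRD C) : minDist C ≤ ∑ i, n i := by
  obtain ⟨j, δ, hδ, hd, -⟩ := hC
  have := sum_Iio_add_le_sum n j
  omega

end Codes

section WeightMultiplicity

variable {F : Type*} [Field F] {t : ℕ} {m n : Fin t → ℕ}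

theorem exists_finrank_le_add_wt_lt (hmn : ∀ i, n i ≤ m i) {U : Code F m n}
    {A : ∀ i : Fin t, Submodule F (Matrix (Fin (m i)) (Fin (n i)) F)}
    (hA : ∀ i, IsOptimalAnticode (A i)) (hU : U ≤ Submodule.pi Set.univ A) {i : Fin t}
    (hi : 0 < maxRank (A i)) :
    ∃ V ≤ U, finrank F U ≤ finrank F V + m i ∧ wt V < ∑ l, maxRank (A l) := by
  obtain ⟨K, hK, hAK, hlt⟩ := (hA i).exists_inf_maxRank_lt (hmn i) hi
  let φ : Ambient F m n →ₗ[F] Matrix (Fin (m i)) (Fin (n i)) F ⧸ K :=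
    K.mkQ ∘ₗ LinearMap.proj i
  let B := Function.update A i (A i ⊓ K)
  have hBi : B i = A i ⊓ K := Function.update_self ..
  have hBl {l} (hl : l ≠ i) : B l = A l := Function.update_of_ne hl ..
  have hB : ∀ l, IsOptimalAnticode (B l) :=
    (Function.forall_update_iff A fun _ => IsOptimalAnticode).2 ⟨hAK, fun l _ => hA l⟩
  have hUB : U ⊓ LinearMap.ker φ ≤ Submodule.pi Set.univ B := by
    rintro X ⟨hXU, hXφ⟩ l -
    rcases eq_or_ne l i with rfl | hl
    · change X l ∈ B l
      rw [hBi]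
      exact ⟨hU hXU l (Set.mem_univ l), (Submodule.Quotient.mk_eq_zero K).1 hXφ⟩
    · change X l ∈ B l
      rw [hBl hl]
      exact hU hXU l (Set.mem_univ l)
  refine ⟨U ⊓ LinearMap.ker φ, inf_le_left,
    (finrank_le_finrank_inf_ker_add U φ).trans (Nat.add_le_add_left hK _),
    (wt_le hB hUB).trans_lt (Finset.sum_lt_sum (fun l _ => ?_)
      ⟨i, Finset.mem_univ i, hBi ▸ hlt⟩)⟩
  rcases eq_or_ne l i with rfl | hl
  · exact hBi ▸ hlt.le
  · rw [hBl hl]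

/-- An anticode of maximum sum-rank `w` around `U` reaches the block of the `w`-th column or a later
one; lowering its rank there costs at most `blockHeight m n w` dimensions, as `m` is antitone. -/
theorem exists_finrank_le_add_blockHeight_wt_lt (hm : Antitone m) (hmn : ∀ i, n i ≤ m i)
    {U : Code F m n} (hU : 0 < wt U) :
    ∃ V ≤ U, finrank F U ≤ finrank F V + blockHeight m n (wt U) ∧ wt V < wt U := by
  obtain ⟨A, hA, hUA, hAw⟩ := exists_anticode_wt hmn U
  obtain ⟨j, δ, hδ, hj⟩ := exists_eq_sum_Iio_add hU (wt_le_sum hmn U)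
  obtain ⟨i, hji, hi⟩ : ∃ i, j ≤ i ∧ 0 < maxRank (A i) := by
    by_contra! hzero
    have hIci : ∑ i ∈ Finset.Ici j, maxRank (A i) = 0 :=
      Finset.sum_eq_zero fun i hi => Nat.le_zero.1 (hzero i (Finset.mem_Ici.1 hi))
    have hIio : ∑ i ∈ Finset.Iio j, maxRank (A i) ≤ ∑ i ∈ Finset.Iio j, n i :=
      Finset.sum_le_sum fun i _ => maxRank_le fun X _ => X.rank_le_width
    rw [← sum_Iio_add_sum_Ici _ j] at hAw
    omega
  obtain ⟨V, hVU, hdim, hwt⟩ := exists_finrank_le_add_wt_lt hmn hA hUA hi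
  rw [hj, blockHeight_sum_Iio_add hδ, ← hj]
  exact ⟨V, hVU, hdim.trans (Nat.add_le_add_left (hm hji) _), hAw ▸ hwt⟩

theorem genWeight_lt_genWeight_add_blockHeight (hm : Antitone m) (hmn : ∀ i, n i ≤ m i)
    (C : Code F m n) {r w : ℕ} (hw : 0 < w) (hr : r + blockHeight m n w ≤ finrank F C)
    (h : genWeight C (r + blockHeight m n w) = w) : genWeight C r < w := by
  obtain ⟨U, hUC, hUr, hUw⟩ := exists_wt_eq_genWeight hr
  rw [h] at hUw
  subst hUw
  obtain ⟨V, hVU, hdim, hwt⟩ := exists_finrank_le_add_blockHeight_wt_lt hm hmn hw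
  exact (genWeight_le (hVU.trans hUC) (by omega)).trans_lt hwt

theorem count_ofFn {α : Type*} [DecidableEq α] {k : ℕ} (g : Fin k → α) (a : α) :
    (List.ofFn g).count a = #{s | g s = a} := by
  rw [← Multiset.coe_count, ← Fin.univ_val_map, Multiset.count_map]
  simp only [eq_comm]
  rfl

theorem count_genWeights_le (hm : Antitone m) (hmn : ∀ i, n i ≤ m i) (C : Code F m n) {w : ℕ}
    (hw : 0 < w) : (genWeights C).count w ≤ blockHeight m n w := by
  rw [genWeights, count_ofFn]
  rcases Finset.eq_empty_or_nonempty {s : Fin (finrank F C) | genWeight C (s + 1) = w}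
    with hE | hne
  · simp [hE]
  obtain ⟨s₀, hs₀, hmin⟩ := Finset.exists_min_image _ id hne
  rw [Finset.mem_filter_univ] at hs₀
  refine (Finset.card_le_card_of_injOn (t := Finset.Ico s₀.1 (s₀.1 + blockHeight m n w))
    Fin.val (fun s hs => ?_) Fin.val_injective.injOn).trans_eq (by simp)
  have hs₀s : s₀.1 ≤ s.1 := hmin s hs
  rw [Finset.coe_filter_univ, Set.mem_ofPred_eq] at hs
  refine Finset.mem_coe.2 (Finset.mem_Ico.2 ⟨hs₀s, ?_⟩)
  by_contra! hlarge
  have heq : s.1 + 1 - blockHeight m n w + blockHeight m n w = s.1 + 1 := by omega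
  have hlt := genWeight_lt_genWeight_add_blockHeight hm hmn C hw
    (heq.trans_le s.2) (by rw [heq, hs])
  have hle := genWeight_mono C (r := s₀.1 + 1) (s := s.1 + 1 - blockHeight m n w) (by omega)
    (by omega)
  omega

end WeightMultiplicity

section InitialSpan

variable {F V : Type*} [Field F] [AddCommGroup V] [Module F V] {k : ℕ} {x : Fin k → V}

/-- The span of the first `r` vectors of a family. -/
def initialSpan (F : Type*) {V : Type*} [Field F] [AddCommGroup V] [Module F V] {k : ℕ}
    (x : Fin k → V) (r : ℕ) : Submodule F V :=
  Submodule.span F (x '' {s | s.1 < r})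

theorem initialSpan_mono (x : Fin k → V) : Monotone (initialSpan F x) :=
  fun _ _ h => Submodule.span_mono (Set.image_mono fun _ hs => lt_of_lt_of_le hs h)

theorem initialSpan_le (x : Fin k → V) (r : ℕ) :
    initialSpan F x r ≤ Submodule.span F (Set.range x) :=
  Submodule.span_mono (Set.image_subset_range _ _)

theorem initialSpan_card (x : Fin k → V) :
    initialSpan F x k = Submodule.span F (Set.range x) := by
  simp [initialSpan]

theorem finrank_span_image (hx : LinearIndependent F x) (S : Set (Fin k)) [Fintype S] :
    finrank F (Submodule.span F (x '' S)) = Fintype.card S := by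
  rw [← finrank_span_eq_card (hx.comp ((↑) : S → Fin k) Subtype.val_injective), Set.range_comp,
    Subtype.range_coe]

theorem finrank_initialSpan (hx : LinearIndependent F x) {r : ℕ} (hr : r ≤ k) :
    finrank F (initialSpan F x r) = r := by
  rw [initialSpan, finrank_span_image hx]
  simp [Fintype.card_subtype, Fin.card_filter_val_lt, hr]

end InitialSpan

section Adapted

variable {F : Type*} [Field F] {t : ℕ} {m n : Fin t → ℕ} {k : ℕ} {g : Fin k → ℕ}
  {x : Fin k → Ambient F m n}

/-- A basis `x` is adapted to the weights `g` if the `s`-th basis vector is supported on the first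
`g s` columns, while no nonzero combination of it and the later basis vectors has sum-rank below
`g s`. Then `g` is the sequence of generalized weights of the span of `x`, and `IsAdapted` passes
to subfamilies. -/
structure IsAdapted (g : Fin k → ℕ) (x : Fin k → Ambient F m n) : Prop where
  mono : Monotone g
  linearIndependent : LinearIndependent F x
  le_sum : ∀ s, g s ≤ ∑ i, n i
  mem_prefixCode : ∀ s, x s ∈ prefixCode F m n (g s)
  le_srk : ∀ s, ∀ X ∈ Submodule.span F (x '' Set.Ici s), X ≠ 0 → g s ≤ srk X

namespace IsAdapted

theorem comp (h : IsAdapted g x) {l : ℕ} (e : Fin l ↪o Fin k) : IsAdapted (g ∘ e) (x ∘ e) where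
  mono := h.mono.comp e.monotone
  linearIndependent := h.linearIndependent.comp e e.injective
  le_sum s := h.le_sum (e s)
  mem_prefixCode s := h.mem_prefixCode (e s)
  le_srk s X hX := h.le_srk (e s) X <| by
    refine Submodule.span_mono ?_ hX
    rintro _ ⟨q, hq, rfl⟩
    exact ⟨e q, e.monotone hq, rfl⟩

theorem finrank_span (h : IsAdapted g x) : finrank F (Submodule.span F (Set.range x)) = k := by
  rw [finrank_span_eq_card h.linearIndependent, Fintype.card_fin]

/-- By dimensions, `U` meets the span of the basis vectors from the `r`-th on. -/
theorem le_wt (hmn : ∀ i, n i ≤ m i) (h : IsAdapted g x) (r : Fin k) {U : Code F m n}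
    (hU : U ≤ Submodule.span F (Set.range x)) (hr : r.1 + 1 ≤ finrank F U) : g r ≤ wt U := by
  let T : Code F m n := Submodule.span F (x '' Set.Ici r)
  have hT : finrank F T = k - r.1 := by
    rw [finrank_span_image h.linearIndependent, Fintype.card_Ici, Fin.card_Ici]
  have hUT : U ⊓ T ≠ ⊥ := fun hbot => by
    have hsup : finrank F ↥(U ⊔ T) ≤ k := h.finrank_span ▸ Submodule.finrank_mono
      (sup_le hU (Submodule.span_mono (Set.image_subset_range _ _)))
    have hadd := Submodule.finrank_sup_add_finrank_inf_eq U T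
    rw [hbot, finrank_bot] at hadd
    omega
  obtain ⟨X, ⟨hXU, hXT⟩, hX⟩ := Submodule.exists_mem_ne_zero_of_ne_bot hUT
  exact (h.le_srk r X hXT hX).trans (srk_le_wt hmn hXU)

theorem wt_initialSpan (hmn : ∀ i, n i ≤ m i) (h : IsAdapted g x) (r : Fin k) :
    wt (initialSpan F x (r + 1)) = g r := by
  refine le_antisymm (wt_le_of_le_prefixCode hmn (h.le_sum r) (Submodule.span_le.2 ?_))
    (h.le_wt hmn r (initialSpan_le x _) (finrank_initialSpan h.linearIndependent r.2).ge)
  rintro _ ⟨s, hs, rfl⟩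
  exact prefixCode_mono (h.mono (Fin.le_def.2 (Nat.lt_succ_iff.1 hs))) (h.mem_prefixCode s)

theorem genWeight_eq (hmn : ∀ i, n i ≤ m i) (h : IsAdapted g x) (r : Fin k) :
    genWeight (Submodule.span F (Set.range x)) (r + 1) = g r := by
  apply le_antisymm
  · rw [← h.wt_initialSpan hmn r]
    exact genWeight_le (initialSpan_le x _) (finrank_initialSpan h.linearIndependent r.2).ge
  · obtain ⟨U, hU, hr, hw⟩ := exists_wt_eq_genWeight (r.2.trans_eq h.finrank_span.symm)
    exact hw ▸ h.le_wt hmn r hU hr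

theorem genWeights_eq (hmn : ∀ i, n i ≤ m i) (h : IsAdapted g x) :
    genWeights (Submodule.span F (Set.range x)) = List.ofFn g := by
  refine List.ext_getElem (by simp [genWeights, h.finrank_span]) fun s h₁ h₂ => ?_
  simp only [genWeights, List.getElem_ofFn]
  exact h.genWeight_eq hmn ⟨s, by simpa using h₂⟩

theorem wt_initialSpan_eq_genWeight (hmn : ∀ i, n i ≤ m i) (h : IsAdapted g x) (r : ℕ)
    (h1 : 1 ≤ r) (hr : r ≤ k) :
    wt (initialSpan F x r) = genWeight (Submodule.span F (Set.range x)) r := by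
  obtain ⟨q, rfl⟩ := Nat.exists_eq_add_of_le' h1
  exact (h.wt_initialSpan hmn ⟨q, hr⟩).trans (h.genWeight_eq hmn ⟨q, hr⟩).symm

theorem chainCondition (hmn : ∀ i, n i ≤ m i) (h : IsAdapted g x) :
    ChainCondition (Submodule.span F (Set.range x)) := by
  refine ⟨initialSpan F x, by simp [initialSpan], ?_, ?_, ?_⟩ <;> rw [h.finrank_span]
  · exact initialSpan_card x
  · intro r hr
    refine Submodule.lt_of_le_of_finrank_lt_finrank (initialSpan_mono x r.le_succ) ?_
    rw [finrank_initialSpan h.linearIndependent hr.le, finrank_initialSpan h.linearIndependent hr]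
    exact r.lt_succ_self
  · exact fun r h1 hr => (h.wt_initialSpan_eq_genWeight hmn r h1 hr).symm

theorem greedyWeights_eq (hmn : ∀ i, n i ≤ m i) (h : IsAdapted g x) :
    greedyWeights (Submodule.span F (Set.range x)) = List.ofFn g := by
  refine List.ext_getElem (by simp [greedyWeights, h.finrank_span]) fun s h₁ h₂ => ?_
  have hs : s < k := by simpa using h₂
  have hgreedy := isGreedySubcode_of_chain (initialSpan F x) (k := k)
    (fun r _ => initialSpan_le x r) (fun r _ => initialSpan_mono x r.le_succ)
    (fun r hr => finrank_initialSpan h.linearIndependent hr)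
    (h.wt_initialSpan_eq_genWeight hmn) (s + 1) (by omega) hs
  simp only [greedyWeights, List.getElem_ofFn]
  rw [← hgreedy.wt_eq_greedyWeight]
  exact h.wt_initialSpan hmn ⟨s, hs⟩

end IsAdapted

end Adapted

section SortedBasis

theorem iSupIndep_of_disjoint_iSup_gt {R V ι : Type*} [Ring R] [AddCommGroup V] [Module R V]
    [LinearOrder ι] {B : ι → Submodule R V} (hB : ∀ i, Disjoint (B i) (⨆ j > i, B j)) :
    iSupIndep B := by
  classical
  rw [iSupIndep_iff_finsetSum_eq_zero_imp_eq_zero]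
  intro s v hv hsum
  by_contra! hne
  obtain ⟨i, hi, hmin⟩ := Finset.exists_min_image {i ∈ s | v i ≠ 0} id
    (hne.imp fun _ => Finset.mem_filter.2)
  rw [Finset.mem_filter] at hi
  have hgt : ∑ j ∈ s.erase i, v j ∈ ⨆ j > i, B j := by
    refine Submodule.sum_mem _ fun j hj => ?_
    rw [Finset.mem_erase] at hj
    rcases eq_or_ne (v j) 0 with h0 | h0
    · exact h0 ▸ zero_mem _
    · exact Submodule.mem_iSup_of_mem j (Submodule.mem_iSup_of_mem
        (lt_of_le_of_ne' (hmin j (Finset.mem_filter.2 ⟨hj.2, h0⟩)) hj.1) (hv j hj.2))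
  rw [← Finset.add_sum_erase s v hi.1] at hsum
  exact hi.2 (Submodule.disjoint_def.1 (hB i) _ (hv i hi.1)
    (eq_neg_of_add_eq_zero_left hsum ▸ neg_mem hgt))

theorem exists_monotone_linearIndependent_mem {F V ι : Type*} [Field F] [AddCommGroup V]
    [Module F V] [FiniteDimensional F V] [Fintype ι] [LinearOrder ι] {B : ι → Submodule F V}
    (hB : iSupIndep B) :
    ∃ (g : Fin (∑ i, finrank F (B i)) → ι) (x : Fin (∑ i, finrank F (B i)) → V),
      Monotone g ∧ LinearIndependent F x ∧ (∀ s, x s ∈ B (g s)) ∧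
        ∀ i, #{s | g s = i} = finrank F (B i) := by
  let y (p : Σ i, Fin (finrank F (B i))) : V := finBasis F (B p.1) p.2
  have hy : LinearIndependent F y := by
    refine linearIndependent_iUnion_finite
      (f := fun i j => (finBasis F (B i) j : V))
      (fun i => (finBasis F (B i)).linearIndependent.map' (B i).subtype (B i).ker_subtype) ?_
    intro i t _ hit
    refine (hB.disjoint_biSup hit).mono ?_ (iSup₂_mono fun j _ => ?_) <;>
    · rw [Submodule.span_le]
      rintro _ ⟨j, rfl⟩
      exact Subtype.prop _
  let e : Fin (∑ i, finrank F (B i)) ≃ Σ i, Fin (finrank F (B i)) :=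
    (Fintype.equivFinOfCardEq (by simp)).symm
  let e' := (Tuple.sort (Sigma.fst ∘ e)).trans e
  refine ⟨Sigma.fst ∘ e', y ∘ e', Tuple.monotone_sort (Sigma.fst ∘ e),
    hy.comp e' e'.injective, fun s => Subtype.prop _, fun i => ?_⟩
  rw [← Fintype.card_fin (finrank F (B i)), ← Fintype.card_subtype]
  exact Fintype.card_congr ((e'.subtypeEquiv fun _ => Iff.rfl).trans (Equiv.sigmaSubtype i))

end SortedBasis

section Chains

variable {F : Type*} [Field F] {t : ℕ} {m n : Fin t → ℕ} {d : ℕ} {E : ℕ → Code F m n}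

theorem prefixDim_add_sum_blockHeight (m n : Fin t → ℕ) {v w : ℕ} (h : v ≤ w) :
    prefixDim m n v + ∑ u ∈ Finset.Icc (v + 1) w, blockHeight m n u = prefixDim m n w := by
  induction w, h using Nat.le_induction with
  | base => simp
  | succ w hvw ih =>
    rw [Finset.sum_Icc_succ_top (by omega), ← add_assoc, ih, blockHeight, Nat.add_sub_cancel,
      Nat.add_sub_of_le (prefixDim_mono m n w.le_succ)]

theorem IsMSRD.finrank_eq_sum_blockHeight {C : Code F m n} (hC : IsMSRD C) :
    finrank F C = ∑ w ∈ Finset.Icc (minDist C) (∑ i, n i), blockHeight m n w := by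
  have hadd := prefixDim_add_sum_blockHeight m n ((Nat.sub_le _ 1).trans hC.minDist_le)
  rw [Nat.sub_add_cancel hC.minDist_pos, ← hC.finrank_add_prefixDim, add_comm] at hadd
  exact (Nat.add_right_cancel hadd).symm

theorem blockHeight_le_finrank_inf_prefixCode {C : Code F m n} (hC : IsMSRD C) :
    blockHeight m n (minDist C) ≤ finrank F ↥(C ⊓ prefixCode F m n (minDist C)) := by
  have hadd := Submodule.finrank_sup_add_finrank_inf_eq C (prefixCode F m n (minDist C))
  have hsup := (C ⊔ prefixCode F m n (minDist C)).finrank_le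
  rw [finrank_ambient, ← hC.finrank_add_prefixDim] at hsup
  rw [finrank_prefixCode] at hadd
  rw [blockHeight]
  omega

theorem iSupIndep_inf_prefixCode (hE : AntitoneOn E (Set.Icc d (∑ i, n i)))
    (hdist : ∀ h ∈ Set.Icc d (∑ i, n i), minDist (E h) = h) :
    iSupIndep fun w : Set.Icc d (∑ i, n i) => E w ⊓ prefixCode F m n w := by
  refine iSupIndep_of_disjoint_iSup_gt fun w => Submodule.disjoint_def.2 fun X hX hXgt => ?_
  by_contra hX0
  obtain ⟨u, hwu⟩ : ∃ u, w < u := by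
    by_contra! hmax
    simp [fun u => (hmax u).not_gt, hX0] at hXgt
  have hw : w.1 + 1 ∈ Set.Icc d (∑ i, n i) :=
    ⟨w.2.1.trans (Nat.le_succ _), (Nat.succ_le_of_lt hwu).trans u.2.2⟩
  have hXE : X ∈ E (w + 1) :=
    (iSup₂_le fun v hv => inf_le_left.trans (hE hw v.2 (Nat.succ_le_of_lt hv)) :
      ⨆ v > w, E v ⊓ prefixCode F m n v ≤ E (w + 1)) hXgt
  have hlt := minDist_le_srk hXE hX0
  rw [hdist _ hw] at hlt
  exact hlt.not_gt (Nat.lt_succ_of_le (srk_le_of_mem_prefixCode w.2.2 hX.2))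

theorem exists_isAdapted (hdn : d ≤ ∑ i, n i)
    (hE : AntitoneOn E (Set.Icc d (∑ i, n i)))
    (hMSRD : ∀ h ∈ Set.Icc d (∑ i, n i), IsMSRD (E h) ∧ minDist (E h) = h) :
    ∃ (k : ℕ) (g : Fin k → ℕ) (x : Fin k → Ambient F m n), IsAdapted g x ∧
      Submodule.span F (Set.range x) = E d ∧
        ∀ w ∈ Set.Icc d (∑ i, n i), blockHeight m n w ≤ (List.ofFn g).count w := by
  obtain ⟨g, x, hg, hx, hxB, hcard⟩ := exists_monotone_linearIndependent_mem
    (iSupIndep_inf_prefixCode hE fun h hh => (hMSRD h hh).2)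
  have hB : ∀ w ∈ Set.Icc d (∑ i, n i), blockHeight m n w ≤
      finrank F ↥(E w ⊓ prefixCode F m n w) := fun w hw => by
    have h := blockHeight_le_finrank_inf_prefixCode (hMSRD w hw).1
    rwa [(hMSRD w hw).2] at h
  have hd : d ∈ Set.Icc d (∑ i, n i) := ⟨le_rfl, hdn⟩
  have hspan : Submodule.span F (Set.range x) = E d := by
    refine Submodule.eq_of_le_of_finrank_le (Submodule.span_le.2 ?_) ?_
    · rintro _ ⟨s, rfl⟩
      exact hE hd (g s).2 (g s).2.1 (hxB s).1
    · rw [finrank_span_eq_card hx, Fintype.card_fin]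
      rw [(hMSRD d hd).1.finrank_eq_sum_blockHeight, (hMSRD d hd).2,
        Finset.sum_subtype _ (p := (· ∈ Set.Icc d (∑ i, n i))) (by simp)]
      exact Finset.sum_le_sum fun w _ => hB w w.2
  refine ⟨_, fun s => g s, x, ⟨hg, hx, fun s => (g s).2.2, fun s => (hxB s).2, ?_⟩, hspan, ?_⟩
  · intro s X hX hX0
    have hXE : X ∈ E (g s) := by
      refine Submodule.span_le.2 ?_ hX
      rintro _ ⟨q, hq, rfl⟩
      exact hE (g s).2 (g q).2 (hg hq) (hxB q).1
    exact (hMSRD _ (g s).2).2 ▸ minDist_le_srk hXE hX0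
  · intro w hw
    rw [count_ofFn]
    refine (hB w hw).trans_eq ((hcard ⟨w, hw⟩).symm.trans ?_)
    simp [Subtype.ext_iff]

end Chains

section Subsequences

variable {F : Type*} [Field F] {t : ℕ} {m n : Fin t → ℕ} {k : ℕ} {g : Fin k → ℕ}

theorem exists_orderEmbedding_of_sublist_ofFn {α : Type*} {g : Fin k → α} {l : List α}
    (h : l.Sublist (List.ofFn g)) : ∃ e : Fin l.length ↪o Fin k, List.ofFn (g ∘ e) = l := by
  obtain ⟨e, he⟩ := List.sublist_iff_exists_fin_orderEmbedding_get_eq.1 h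
  refine ⟨e.trans (Fin.castOrderIso List.length_ofFn).toOrderEmbedding, ?_⟩
  refine List.ext_get (by simp) fun s h₁ h₂ => ?_
  rw [he ⟨s, h₂⟩, List.get_ofFn, List.get_ofFn]
  rfl

theorem genWeights_sublist_ofFn (hm : Antitone m) (hmn : ∀ i, n i ≤ m i) {C D : Code F m n}
    (hCD : C ≤ D) (hD : 0 < minDist D) (hg : Monotone g)
    (hcount : ∀ w ∈ Set.Icc (minDist D) (∑ i, n i),
      blockHeight m n w ≤ (List.ofFn g).count w) :
    (genWeights C).Sublist (List.ofFn g) := by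
  refine List.sublist_of_subperm_of_sortedLE (List.subperm_ext_iff.2 fun w hw => ?_)
    (Monotone.sortedLE_ofFn fun r s hrs => genWeight_mono C (Nat.succ_le_succ hrs) s.2)
    hg.sortedLE_ofFn
  obtain ⟨s, rfl⟩ := List.mem_ofFn.1 hw
  obtain ⟨U, -, -, hU⟩ := exists_wt_eq_genWeight (C := C) (r := s + 1) s.2
  have hle := minDist_le_genWeight hmn hCD s.1.succ_pos s.2
  exact (count_genWeights_le hm hmn C (hD.trans_le hle)).trans
    (hcount _ ⟨hle, hU ▸ wt_le_sum hmn U⟩)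

theorem IsAdapted.exists_le_of_sublist {x : Fin k → Ambient F m n} (hmn : ∀ i, n i ≤ m i)
    (h : IsAdapted g x) {l : List ℕ} (hl : l.Sublist (List.ofFn g)) :
    ∃ C ≤ Submodule.span F (Set.range x),
      genWeights C = l ∧ ChainCondition C ∧ greedyWeights C = l := by
  obtain ⟨e, hge⟩ := exists_orderEmbedding_of_sublist_ofFn hl
  have he := h.comp e
  exact ⟨_, Submodule.span_mono (Set.range_comp_subset_range e x), (he.genWeights_eq hmn).trans hge,
    he.chainCondition hmn, (he.greedyWeights_eq hmn).trans hge⟩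

end Subsequences

end SumRank

open SumRank in
theorem theorem4p6_general {F : Type*} [Field F] {t : ℕ} {m n : Fin t → ℕ} (hm : Antitone m)
    (hmn : ∀ i, n i ≤ m i) {d : ℕ} (hdn : d ≤ ∑ i, n i) (E : ℕ → Code F m n)
    (hchain : ∀ h, d ≤ h → h < ∑ i, n i → E (h + 1) ≤ E h)
    (hMSRD : ∀ h, d ≤ h → h ≤ ∑ i, n i → IsMSRD (E h) ∧ minDist (E h) = h) :
    (∀ l : List ℕ, (∃ C : Code F m n, C ≤ E d ∧ genWeights C = l) ↔
      l.length ≤ Module.finrank F (E d) ∧ List.Sublist l (genWeights (E d))) ∧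
    (∀ l : List ℕ, List.Sublist l (genWeights (E d)) →
      ∃ C : Code F m n, C ≤ E d ∧ genWeights C = l ∧ ChainCondition C ∧ greedyWeights C = l) := by
  have hE : AntitoneOn E (Set.Icc d (∑ i, n i)) :=
    antitoneOn_of_add_one_le Set.ordConnected_Icc fun h _ hh hh' => hchain h hh.1 hh'.2
  obtain ⟨k, g, x, hgx, hspan, hcount⟩ := exists_isAdapted hdn hE fun h hh => hMSRD h hh.1 hh.2
  obtain ⟨hD, hd⟩ := hMSRD d le_rfl hdn
  have hgD : genWeights (E d) = List.ofFn g := hspan ▸ hgx.genWeights_eq hmn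
  rw [hgD]
  have hexists := fun l hl => hgx.exists_le_of_sublist hmn (l := l) hl
  rw [hspan] at hexists
  refine ⟨fun l => ⟨?_, fun hl => ?_⟩, hexists⟩
  · rintro ⟨C, hC, rfl⟩
    refine ⟨by simpa [genWeights] using Submodule.finrank_mono hC, ?_⟩
    exact genWeights_sublist_ofFn hm hmn hC hD.minDist_pos hgx.mono (hd.symm ▸ hcount)
  · obtain ⟨C, hC, hCl, -⟩ := hexists l hl.2
    exact ⟨C, hC, hCl⟩

theorem theorem4p6 {F : Type*} [Field F] [Finite F] {t : ℕ} (m n : Fin t → ℕ)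
    (hn : ∀ i, 0 < n i) (hm : Antitone m) (hmn : ∀ i, n i ≤ m i)
    (D : SumRank.Code F m n) (hD : SumRank.IsMSRD D)
    (d : ℕ) (hd : SumRank.minDist D = d)
    -- the chain `D = E d ⊇ E (d + 1) ⊇ ⋯ ⊇ E (n₁ + ⋯ + n_t)` of MSRD codes
    (E : ℕ → SumRank.Code F m n) (hE : E d = D)
    (hchain : ∀ h, d ≤ h → h < ∑ i, n i → E (h + 1) ≤ E h)
    (hMSRD : ∀ h, d ≤ h → h ≤ ∑ i, n i →
      SumRank.IsMSRD (E h) ∧ SumRank.minDist (E h) = h) :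
    (∀ l : List ℕ, (∀ x ∈ l, 0 < x) →
      ((∃ C : SumRank.Code F m n, C ≤ D ∧ SumRank.genWeights C = l) ↔
        l.length ≤ Module.finrank F D ∧ List.Sublist l (SumRank.genWeights D))) ∧
    (∀ l : List ℕ, List.Sublist l (SumRank.genWeights D) →
      ∃ C : SumRank.Code F m n, C ≤ D ∧ SumRank.genWeights C = l ∧
        SumRank.ChainCondition C ∧ SumRank.greedyWeights C = l) := by
  subst hE
  have h := theorem4p6_general hm hmn (hd ▸ hD.minDist_le) E hchain hMSRD
  exact ⟨fun l _ => h.1 l, h.2⟩
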